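/- **Setting.** Let $X$ be a continuous-time Markov chain on a probability space $(\Omega,\mathcal F,\mathbb P)$ with values in the standard basis $\{e_1,\dots,e_N\}$ of $\mathbb R^N$, with right-continuous paths having left limits, deterministic initial value $X_0$ and a bounded, measurable, possibly time-dependent rate matrix $A_t$ ($(A_t)_{ij}\ge 0$ for $i\ne j$ is the rate of jumping from $e_j$ to $e_i$, and the columns of $A_t$ sum to $0$). Assume $\mathbb P(X_t=e_i)>0$ for all $t>0$ and all $i$. Let $(\mathcal F_t)$ be the filtration generated by $X$ and the $\mathbb P$-null events, and let $M_t=X_t-X_0-\int_{]0,t]}A_uX_{u-}\,du$. For $z\in\mathbb R^N$ put $$\|z\|_{M_t}^2=z^*\big(\mathrm{diag}(A_tX_{t-})-A_t\,\mathrm{diag}(X_{t-})-\mathrm{diag}(X_{t-})A_t^*\big)z,$$ and write $Z\sim_M Z'$ if $\|Z_t-Z'_t\|_{M_t}=0$ $dt\times d\mathbb P$-a.e. For a progressively measurable $f:\Omega\times\mathbb R^+\times\mathbb R\times\mathbb R^N\to\mathbb R$, a *solution* $(Y,Z)$ of $$dY_t=-f(\omega,t,Y_{t-},Z_t)\,dt+Z_t^*\,dM_t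 \tag{1}$$ consists of an adapted real process $Y$ with $E[\sup_{t<T}Y_t^2]<\infty$ for all $T$ and a predictable $\mathbb R^N$-valued process $Z$ such that both integrals exist pathwise and (1) holds in integrated form, up to indistinguishability. The driver $f$ is *$\sim_M$-invariant* if for all predictable $Z\sim_M Z'$ one has $f(\omega,t,y,Z_t)=f(\omega,t,y,Z'_t)$ for all $y$, $dt\times d\mathbb P$-a.e. **Theorem.** Let $f$ be progressively measurable and let $(Y,Z)$ be a solution of (1). The following are equivalent. 1. Up to indistinguishability, $Y_t=u(t,X_t)$ for some deterministic function $u$. 2. There is a function $\tilde f:\{e_1,\dots,e_N\}\times\mathbb R^+\times\mathbb R\times\mathbb R^N\to\mathbb R$, such that $(\omega,t,y,z)\mapsto\tilde f(X_t,t,y,z)$ is progressively measurable and $\sim_M$-invariant, with the following properties. * (i) $f(\omega,t,Y_t,Z_t)=\tilde f(X_t,t,Y_t,Z_t)$ $dt\times d\mathbb P$-a.e., and $Y$ is, up to indistinguishability, the only process $Y'$ with $Y'_0=Y_0$ a.s. for which $(Y',Z)$ is a solution of $dY'_t=-\tilde f(X_t,t,Y'_{t-},Z_t)\,dt+Z_t^*\,dM_t$.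 * (ii) $Z\sim_M v$ for a deterministic function $v:\mathbb R^+\to\mathbb R^N$ with $X_0^*v_0=Y_0$ a.s., with $E[\sup_{t<T}(X_t^*v_t)^2]<\infty$ for all $T$, and such that for all $i$ $$\frac{d(e_i^*v_t)}{dt}=-\tilde f(e_i,t,e_i^*v_t,v_t)-v_t^*A_te_i \tag{2}$$ in integrated form on $t>0$, and for $e_i=X_0$ on $t\ge 0$ (the right-hand side being integrable on every $]s,t]$ with $0<s\le t$, respectively $0\le s\le t$). In that case, for every $u$ as in 1, one has $Z\sim_M (u(t,e_i))_{i=1}^N$. This function $v_t=(u(t,e_i))_i$ satisfies all of (ii) with every $\tilde f$ that is as in 2, even if the uniqueness in (i) is not required of it. Every $v$ as in 2 satisfies $e_i^*v_t=u(t,e_i)$ for all $i$ and all $t>0$. -/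

import Mathlib

open MeasureTheory Set Filter Topology
open scoped NNReal ENNReal Matrix

namespace MarkovBSDE

noncomputable section

/-- Lebesgue measure `dt` on the time axis `[0, ∞)`. -/
def timeMeasure : Measure ℝ≥0 := (volume : Measure ℝ).comap ((↑) : ℝ≥0 → ℝ)

/-- The standard basis vector `e_i` of `ℝ^N`. -/
def e {N : ℕ} (i : Fin N) : Fin N → ℝ := Pi.single i 1

section Chain

variable {Ω : Type*} [m : MeasurableSpace Ω]

/-- The filtration `σ(X_s, s ≤ t) ∨ {B : P(B) = 0}` generated by `X` and the null events. -/
def augmentedFiltration {N : ℕ} (P : Measure Ω) (X : ℝ≥0 → Ω → Fin N)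
    (hX : ∀ t, Measurable (X t)) : Filtration ℝ≥0 m where
  seq t := (⨆ s ≤ t, MeasurableSpace.comap (X s) inferInstance) ⊔
    MeasurableSpace.generateFrom {B | MeasurableSet B ∧ P B = 0}
  mono' := by
    intro s t hst
    exact sup_le_sup_right
      (iSup₂_le fun r hr =>
        le_iSup₂_of_le (f := fun s (_ : s ≤ t) => MeasurableSpace.comap (X s) inferInstance)
          r (hr.trans hst) le_rfl) _
  le' := by
    intro t
    refine sup_le (iSup₂_le fun s _ => (hX s).comap_le) ?_
    exact MeasurableSpace.generateFrom_le fun B hB => hB.1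

/-- `A` is a bounded, measurable, time-dependent rate matrix; `A t i j` is the rate of jumping from
state `j` to state `i`. -/
structure IsRateMatrix {N : ℕ} (A : ℝ≥0 → Matrix (Fin N) (Fin N) ℝ) : Prop where
  measurable : ∀ i j, Measurable fun t => A t i j
  bounded : ∃ K : ℝ, ∀ t i j, |A t i j| ≤ K
  nonneg : ∀ t i j, i ≠ j → 0 ≤ A t i j
  sum_eq_zero : ∀ t j, ∑ i, A t i j = 0

/-- `p s t` is the family of transition matrices of the rate matrix `A`: the solution of Kolmogorov's
forward equation `∂ₜ p(s,t) = Aₜ p(s,t)`, `p(s,s) = I`, in integrated form. The entry `p s t i j` is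
the probability to be in state `i` at time `t` when starting in state `j` at time `s`. -/
structure IsTransitionFunction {N : ℕ} (A : ℝ≥0 → Matrix (Fin N) (Fin N) ℝ)
    (p : ℝ≥0 → ℝ≥0 → Matrix (Fin N) (Fin N) ℝ) : Prop where
  continuousOn : ∀ s i j, ContinuousOn (fun t => p s t i j) (Ici s)
  forward : ∀ s t, s ≤ t → ∀ i j,
    p s t i j = (1 : Matrix (Fin N) (Fin N) ℝ) i j + ∫ u in Ioc s t, (A u * p s u) i j ∂timeMeasure

/-- A continuous-time Markov chain with `N` states and bounded rate matrix `A` on `(Ω, P)`. The state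
`i` stands for the basis vector `e i`. The Markov property is stated with respect to the augmented
filtration of the chain, with the transition matrices of `A`. The initial state is deterministic, and
every state is charged at every positive time. -/
structure MarkovChain (P : Measure Ω) (N : ℕ) where
  /-- the chain -/
  X : ℝ≥0 → Ω → Fin N
  /-- the rate matrix -/
  A : ℝ≥0 → Matrix (Fin N) (Fin N) ℝ
  /-- the initial state -/
  x₀ : Fin N
  measurable_X : ∀ t, Measurable (X t)
  rightCts : ∀ ω t, ∀ᶠ s in 𝓝[>] t, X s ω = X t ω
  leftLimits : ∀ ω t, 0 < t → ∃ i, ∀ᶠ s in 𝓝[<] t, X s ω = i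
  isRateMatrix : IsRateMatrix A
  markov : ∃ p, IsTransitionFunction A p ∧ ∀ s t, s ≤ t → ∀ i,
    P[fun ω => e (X t ω) i | augmentedFiltration P X measurable_X s]
      =ᵐ[P] fun ω => p s t i (X s ω)
  initial : ∀ᵐ ω ∂P, X 0 ω = x₀
  charged : ∀ t, 0 < t → ∀ i, 0 < P {ω | X t ω = i}

namespace MarkovChain

variable {P : Measure Ω} {N : ℕ} (C : MarkovChain P N)

/-- The filtration `ℱ_t` of the chain. -/
def ℱ : Filtration ℝ≥0 m := augmentedFiltration P C.X C.measurable_X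

/-- The vector `X_t` of `ℝ^N`. -/
def vec (t : ℝ≥0) (ω : Ω) : Fin N → ℝ := e (C.X t ω)

/-- The left limit `X_{t-}` as a vector of `ℝ^N` (with `X_{0-} = X_0`). -/
def vecLeft (t : ℝ≥0) (ω : Ω) : Fin N → ℝ := e (Function.leftLim (fun s => C.X s ω) t)

/-- The matrix `diag(A x) - A diag(x) - diag(x) A^*`; at `A = A_t` and `x = X_{t-}` this is the
density `d⟨M, M⟩_t / dt`. -/
def Psi (A : Matrix (Fin N) (Fin N) ℝ) (x : Fin N → ℝ) : Matrix (Fin N) (Fin N) ℝ :=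
  Matrix.diagonal (A *ᵥ x) - A * Matrix.diagonal x - Matrix.diagonal x * Aᵀ

/-- The stochastic seminorm `‖z‖_{M_t}` of a vector `z`. -/
def seminormM (t : ℝ≥0) (ω : Ω) (z : Fin N → ℝ) : ℝ :=
  Real.sqrt (z ⬝ᵥ (Psi (C.A t) (C.vecLeft t ω) *ᵥ z))

/-- `Z ∼_M Z'`: `‖Z_t - Z'_t‖_{M_t} = 0` for `dt × dP`-almost all `(t, ω)`. -/
def EquivM (Z Z' : ℝ≥0 → Ω → Fin N → ℝ) : Prop :=
  ∀ᵐ q ∂timeMeasure.prod P, C.seminormM q.1 q.2 (Z q.1 q.2 - Z' q.1 q.2) = 0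

/-- The integrand `Z` is pathwise integrable with respect to the finite variation process `M`. -/
def IntegrableM (Z : ℝ≥0 → Ω → Fin N → ℝ) : Prop :=
  ∀ᵐ ω ∂P, ∀ t : ℝ≥0,
    IntegrableOn (fun u => Z u ω ⬝ᵥ (C.A u *ᵥ C.vecLeft u ω)) (Ioc 0 t) timeMeasure

/-- The integral `∫_{]0,t]} Z_u^* dM_u`. The paths of `M_t = X_t - X_0 - ∫_{]0,t]} A_u X_{u-} du` have
finite variation on compacts: `M` has the finitely many jumps of `X` and the continuous part
`-∫ A_u X_{u-} du`. So this is the pathwise Lebesgue-Stieltjes integral, that is, the (finite) sum of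
`Z_s^* ΔX_s` over the jump times `s ≤ t` minus `∫_{]0,t]} Z_u^* A_u X_{u-} du`. -/
def integralM (Z : ℝ≥0 → Ω → Fin N → ℝ) (t : ℝ≥0) (ω : Ω) : ℝ :=
  (∑ᶠ s ∈ Ioc 0 t, Z s ω ⬝ᵥ (C.vec s ω - C.vecLeft s ω)) -
    ∫ u in Ioc 0 t, Z u ω ⬝ᵥ (C.A u *ᵥ C.vecLeft u ω) ∂timeMeasure

/-- `f(ω, t, y, z)` is progressively measurable. -/
def ProgressiveDriver (f : Ω → ℝ≥0 → ℝ → (Fin N → ℝ) → ℝ) : Prop :=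
  ∀ T : ℝ≥0,
    Measurable[(Subtype.instMeasurableSpace.prod (C.ℱ T)).prod
        ((inferInstance : MeasurableSpace ℝ).prod (inferInstance : MeasurableSpace (Fin N → ℝ)))]
      fun q : (Iic T × Ω) × ℝ × (Fin N → ℝ) => f q.1.2 q.1.1 q.2.1 q.2.2

/-- `f(ω, t, y, ·)` is invariant with respect to `∼_M`: if `Z ∼_M Z'` are predictable then
`f(ω, t, y, Z_t) = f(ω, t, y, Z'_t)` for all `y`, for `dt × dP`-almost all `(t, ω)`. -/
def InvariantDriver (f : Ω → ℝ≥0 → ℝ → (Fin N → ℝ) → ℝ) : Prop :=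
  ∀ Z Z' : ℝ≥0 → Ω → Fin N → ℝ,
    IsStronglyPredictable C.ℱ Z → IsStronglyPredictable C.ℱ Z' → C.EquivM Z Z' →
      ∀ᵐ q ∂timeMeasure.prod P, ∀ y : ℝ, f q.2 q.1 y (Z q.1 q.2) = f q.2 q.1 y (Z' q.1 q.2)

/-- `E[sup_{t < T} Y_t²] < ∞` for all `T`. -/
def SquareIntegrableSup (P : Measure Ω) (Y : ℝ≥0 → Ω → ℝ) : Prop :=
  ∀ T : ℝ≥0, ∫⁻ ω, ⨆ t : ℝ≥0, ⨆ _ : t < T, ENNReal.ofReal (Y t ω ^ 2) ∂P < ∞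

/-- The pair `(Y, Z)` solves `dY_t = -f(ω, t, Y_{t-}, Z_t) dt + Z_t^* dM_t`: `Y` is adapted with
`E[sup_{t < T} Y_t²] < ∞` for all `T`, `Z` is predictable, both integrals exist, and the
integrated equation holds up to indistinguishability. -/
structure IsSolution (f : Ω → ℝ≥0 → ℝ → (Fin N → ℝ) → ℝ) (Y : ℝ≥0 → Ω → ℝ)
    (Z : ℝ≥0 → Ω → Fin N → ℝ) : Prop where
  adapted : StronglyAdapted C.ℱ Y
  squareIntegrable : SquareIntegrableSup P Y
  predictable : IsStronglyPredictable C.ℱ Z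
  integrable_driver : ∀ᵐ ω ∂P, ∀ t : ℝ≥0,
    IntegrableOn (fun u => f ω u (Function.leftLim (fun s => Y s ω) u) (Z u ω)) (Ioc 0 t)
      timeMeasure
  integrableM : C.IntegrableM Z
  equation : ∀ᵐ ω ∂P, ∀ t : ℝ≥0,
    Y t ω = Y 0 ω
      - ∫ u in Ioc 0 t, f ω u (Function.leftLim (fun s => Y s ω) u) (Z u ω) ∂timeMeasure
      + C.integralM Z t ω

/-- The forward equation with driver `f`, integrand `Z` and initial value `Y_0` has no other solution
than `Y`, up to indistinguishability. -/
def IsOnlySolution (f : Ω → ℝ≥0 → ℝ → (Fin N → ℝ) → ℝ) (Y : ℝ≥0 → Ω → ℝ)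
    (Z : ℝ≥0 → Ω → Fin N → ℝ) : Prop :=
  ∀ Y' : ℝ≥0 → Ω → ℝ, C.IsSolution f Y' Z → Y' 0 =ᵐ[P] Y 0 → ∀ᵐ ω ∂P, ∀ t, Y' t ω = Y t ω

/-- The driver `(ω, t, y, z) ↦ f̃(X_t, t, y, z)`. -/
def chainDriver (F : Fin N → ℝ≥0 → ℝ → (Fin N → ℝ) → ℝ) :
    Ω → ℝ≥0 → ℝ → (Fin N → ℝ) → ℝ :=
  fun ω t y z => F (C.X t ω) t y z

/-- `Y_t = u(t, X_t)` up to indistinguishability; `u t i` stands for `u(t, e_i)`. -/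
def IsFunctionOfChain (Y : ℝ≥0 → Ω → ℝ) (u : ℝ≥0 → Fin N → ℝ) : Prop :=
  ∀ᵐ ω ∂P, ∀ t, Y t ω = u t (C.X t ω)

/-- `f(ω, t, Y_t, Z_t) = f̃(X_t, t, Y_t, Z_t)` for `dt × dP`-almost all `(t, ω)`, where
`f̃(X_t, t, y, z)` is again progressively measurable and invariant under `∼_M`. -/
structure IsMarkovianVersion (f : Ω → ℝ≥0 → ℝ → (Fin N → ℝ) → ℝ) (Y : ℝ≥0 → Ω → ℝ)
    (Z : ℝ≥0 → Ω → Fin N → ℝ) (F : Fin N → ℝ≥0 → ℝ → (Fin N → ℝ) → ℝ) : Prop where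
  progressive : C.ProgressiveDriver (C.chainDriver F)
  invariant : C.InvariantDriver (C.chainDriver F)
  eq : ∀ᵐ q ∂timeMeasure.prod P,
    f q.2 q.1 (Y q.1 q.2) (Z q.1 q.2) = F (C.X q.1 q.2) q.1 (Y q.1 q.2) (Z q.1 q.2)

/-- The deterministic function `v` solves the system
`d(e_i^* v_t)/dt = -f̃(e_i, t, e_i^* v_t, v_t) - v_t^* A_t e_i` in integrated form: for every `i` on the
times `t > 0`, and for the initial state `i = x₀` on `t ≥ 0`. -/
def SolvesSystem (F : Fin N → ℝ≥0 → ℝ → (Fin N → ℝ) → ℝ) (v : ℝ≥0 → Fin N → ℝ) : Prop :=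
  ∀ (i : Fin N) (s t : ℝ≥0), s ≤ t → (0 < s ∨ i = C.x₀) →
    IntegrableOn (fun u => -F i u (v u i) (v u) - v u ⬝ᵥ (C.A u *ᵥ e i)) (Ioc s t) timeMeasure ∧
    v t i = v s i + ∫ u in Ioc s t, (-F i u (v u i) (v u) - v u ⬝ᵥ (C.A u *ᵥ e i)) ∂timeMeasure

/-- Up to `∼_M` equivalence, `Z` is the deterministic function `v`, which satisfies
`X_0^* v_0 = Y_0`, solves the system for `f̃`, and for which `X_t^* v_t` satisfies the integrability
condition imposed on solutions of the equation. -/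
structure IsDeterministicVersion (F : Fin N → ℝ≥0 → ℝ → (Fin N → ℝ) → ℝ) (Y : ℝ≥0 → Ω → ℝ)
    (Z : ℝ≥0 → Ω → Fin N → ℝ) (v : ℝ≥0 → Fin N → ℝ) : Prop where
  equiv : C.EquivM Z (fun t _ => v t)
  initial : ∀ᵐ ω ∂P, C.vec 0 ω ⬝ᵥ v 0 = Y 0 ω
  system : C.SolvesSystem F v
  squareIntegrable : SquareIntegrableSup P (fun t ω => C.vec t ω ⬝ᵥ v t)

end MarkovChain

end Chain

end

end MarkovBSDE

namespace MarkovBSDE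

/-! Between jumps of `X`, equation (1) is an ordinary integral equation along the path; at a jump,
`Y` moves by `Z^* ΔX`. Both implications are obtained by reading (1) path by path.

Suppose `Y_t = u(t, X_t)`. Every state `i` is charged at every time `r > 0`, and almost surely `r`
is not a jump time, so every almost sure event contains a path that stays in `i` near `r`
(`exists_path`). On it `Y` is `u(·, e_i)`, and (1) makes this deterministic function a primitive of
the drift near `r`. Hence `u(·, e_i)` is continuous on `t > 0`, the jump of `Y` at `t` is `u(t, X_t)
- u(t, X_{t-})`, and therefore `Z` and `u` have the same jump integrals, which means `Z ∼_M u`.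
Taking `f̃(e_i, t, y, z) = -∂_t u(t, e_i) - u(t)^* A_t e_i`, independent of `y` and `z`, makes
invariance and uniqueness automatic. Conversely, if `Z ∼_M v` and `v` solves (2), then `v(t, X_t)`
solves the equation for `f̃` with initial value `Y_0`, and uniqueness forces it to be `Y`.

The probabilistic core is `equivM_iff`. On `X_{t-} = e_j` the squared seminorm of `z` is `∑_i A_ij
(z_i - z_j)^2`, so `∼_M` compares increments along transitions of positive rate, `dt × dP`-a.e. The
Lévy system `meanJumps_eq_lintegral` turns this into a statement about the actual jumps. It comes
from subtracting a pathwise count of entries and exits of a state from the forward equation on past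
events, and extending from predictable rectangles to all predictable sets. -/

/-! ### Induction along the time axis. -/

/-- Continuous induction: the set of `x` up to which `R s` holds is closed in `[s, t]` and can be
continued to the right of each of its points, both by transitivity through a point of the local
neighbourhood. -/
theorem rel_of_locally_rel {R : ℝ≥0 → ℝ≥0 → Prop}
    (trans : ∀ a b c, a ≤ b → b ≤ c → R a b → R b c → R a c) {s t : ℝ≥0} (hst : s ≤ t)
    (loc : ∀ r, s ≤ r → r ≤ t → ∃ U ∈ 𝓝 r, ∀ a ∈ U, ∀ b ∈ U, s ≤ a → a ≤ b → b ≤ t → R a b) :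
    R s t := by
  let S : Set ℝ≥0 := {x | ∀ y, s ≤ y → y ≤ x → R s y}
  have hS : Icc s t ⊆ S := by
    apply IsClosed.Icc_subset_of_forall_mem_nhdsWithin
    · refine isClosed_of_closure_subset fun x hx => ?_
      have hxI : x ∈ Icc s t := closure_minimal inter_subset_right isClosed_Icc hx
      refine ⟨fun y hsy hyx => ?_, hxI⟩
      rcases hyx.lt_or_eq with h | rfl
      · obtain ⟨z, hz, hzS⟩ := mem_closure_iff_nhds.1 hx _ (Ioi_mem_nhds h)
        exact hzS.1 y hsy (le_of_lt hz)
      · obtain ⟨U, hU, hR⟩ := loc y hxI.1 hxI.2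
        obtain ⟨z, hz, hzS⟩ := mem_closure_iff_nhds.1 hx _ hU
        rcases le_total y z with h | h
        · exact hzS.1 y hsy h
        · exact trans _ _ _ hzS.2.1 h (hzS.1 z hzS.2.1 le_rfl)
            (hR z hz y (mem_of_mem_nhds hU) hzS.2.1 h hxI.2)
    · intro y h1 h2
      obtain rfl := le_antisymm h1 h2
      obtain ⟨U, hU, hR⟩ := loc s le_rfl hst
      exact hR s (mem_of_mem_nhds hU) s (mem_of_mem_nhds hU) le_rfl le_rfl hst
    · rintro x ⟨hxS, hx⟩
      obtain ⟨U, hU, hR⟩ := loc x hx.1 hx.2.le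
      obtain ⟨c, hc, hcU⟩ := (mem_nhdsGE_iff_exists_Ico_subset' hx.2).1
        (mem_nhdsWithin_of_mem_nhds hU)
      filter_upwards [Ioo_mem_nhdsGT (lt_min hc hx.2)] with z hz y hsy hyz
      rcases le_total y x with h | h
      · exact hxS y hsy h
      · have hz' := lt_min_iff.1 hz.2
        exact trans _ _ _ hx.1 h (hxS x hx.1 le_rfl) (hR x (mem_of_mem_nhds hU) y
          (hcU ⟨h, hyz.trans_lt hz'.1⟩) hx.1 h (hyz.trans hz'.2.le))
  exact hS (right_mem_Icc.2 hst) t hst le_rfl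

/-- A right-continuous path with left limits in a discrete state space. -/
structure IsStepPath {α : Type*} (x : ℝ≥0 → α) : Prop where
  rightCts : ∀ t, ∀ᶠ s in 𝓝[>] t, x s = x t
  leftLimits : ∀ t, 0 < t → ∃ i, ∀ᶠ s in 𝓝[<] t, x s = i

/-- Near `r` the path has one value before `r` and one from `r` on. Pathwise identities that add up
over adjacent intervals thus need checking only where the path is constant on `[a, b)`; a jump at
`b` is allowed. -/
theorem IsStepPath.rel_of_rel_of_const {α : Type*} {x : ℝ≥0 → α} (hx : IsStepPath x)
    {R : ℝ≥0 → ℝ≥0 → Prop} (refl : ∀ a, R a a)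
    (trans : ∀ a b c, a ≤ b → b ≤ c → R a b → R b c → R a c)
    (const : ∀ a b, a < b → (∀ s ∈ Ico a b, x s = x a) → R a b) {s t : ℝ≥0} (hst : s ≤ t) :
    R s t := by
  refine rel_of_locally_rel trans hst fun r _ _ => ?_
  obtain ⟨i, hi⟩ : ∃ i, ∀ᶠ s in 𝓝[<] r, x s = i := by
    rcases eq_zero_or_pos r with rfl | h
    · exact ⟨x 0, by simp⟩
    · exact hx.leftLimits r h
  have h2 := hx.rightCts r
  rw [eventually_nhdsWithin_iff] at hi h2
  obtain ⟨U, hU, hUo⟩ : ∃ U ∈ 𝓝 r, OrdConnected U ∧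
      ∀ y ∈ U, (y ∈ Iio r → x y = i) ∧ (y ∈ Ioi r → x y = x r) := by
    obtain ⟨a, b, -, hn, hsub⟩ := exists_Icc_mem_subset_of_mem_nhds (hi.and h2)
    exact ⟨Icc a b, hn, ordConnected_Icc, hsub⟩
  obtain ⟨hU1, hU2⟩ := hUo
  have key1 : ∀ a ∈ U, ∀ b ∈ U, a ≤ b → b ≤ r → R a b := by
    intro a ha b hb hab hbr
    rcases hab.eq_or_lt with rfl | hab
    · exact refl a
    refine const a b hab fun y hy => ?_
    rw [(hU2 y (hU1.out ha hb ⟨hy.1, hy.2.le⟩)).1 (hy.2.trans_le hbr),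
      (hU2 a ha).1 (hab.trans_le hbr)]
  have key2 : ∀ a ∈ U, ∀ b ∈ U, a ≤ b → r ≤ a → R a b := by
    intro a ha b hb hab hbr
    rcases hab.eq_or_lt with rfl | hab
    · exact refl a
    refine const a b hab fun y hy => ?_
    have : ∀ y ∈ U, r ≤ y → x y = x r := fun y hy h => by
      rcases h.eq_or_lt with rfl | h
      · rfl
      · exact (hU2 y hy).2 h
    rw [this y (hU1.out ha hb ⟨hy.1, hy.2.le⟩) (hbr.trans hy.1), this a ha hbr]
  refine ⟨U, hU, fun a ha b hb _ hab _ => ?_⟩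
  rcases le_total b r with h | h
  · exact key1 a ha b hb hab h
  rcases le_total r a with h' | h'
  · exact key2 a ha b hb hab h'
  · have hr := mem_of_mem_nhds hU
    exact trans _ _ _ h' h (key1 a ha r hr h' le_rfl) (key2 r hr b hb h le_rfl)

/-! ### Lebesgue measure on the half-line, and primitives. -/

theorem measurableEmbedding_coe_nnreal : MeasurableEmbedding ((↑) : ℝ≥0 → ℝ) :=
  MeasurableEmbedding.subtype_coe measurableSet_Ici

theorem map_coe_timeMeasure :
    timeMeasure.map ((↑) : ℝ≥0 → ℝ) = (volume : Measure ℝ).restrict (Ici 0) := by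
  rw [timeMeasure, measurableEmbedding_coe_nnreal.map_comap]
  congr 1
  exact Subtype.range_coe

theorem timeMeasure_Ioc (s t : ℝ≥0) : timeMeasure (Ioc s t) = ENNReal.ofReal (t - s) := by
  rw [timeMeasure, measurableEmbedding_coe_nnreal.comap_apply, NNReal.image_coe_Ioc,
    Real.volume_Ioc]

instance : NullSingletonClass timeMeasure where
  measure_singleton x := by
    rw [timeMeasure, measurableEmbedding_coe_nnreal.comap_apply]
    simp

instance : IsLocallyFiniteMeasure timeMeasure where
  finiteAtNhds x := by
    refine ⟨Iio (x + 1), Iio_mem_nhds (by simp), ?_⟩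
    refine (measure_mono (fun y hy => ?_ : Iio (x + 1) ⊆ {0} ∪ Ioc 0 (x + 1))).trans_lt
      ((measure_union_le _ _).trans_lt ?_)
    · rcases eq_zero_or_pos y with h | h
      · exact Or.inl h
      · exact Or.inr ⟨h, le_of_lt hy⟩
    · rw [measure_singleton, zero_add, timeMeasure_Ioc]
      exact ENNReal.ofReal_lt_top

theorem integrableOn_timeMeasure_iff (g : ℝ≥0 → ℝ) {s t : ℝ≥0} (hst : s ≤ t) :
    IntegrableOn g (Ioc s t) timeMeasure ↔
      IntervalIntegrable (fun x : ℝ => g x.toNNReal) volume s t := by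
  have h := measurableEmbedding_coe_nnreal.integrableOn_map_iff (μ := timeMeasure)
    (f := fun x : ℝ => g x.toNNReal) (s := Ioc (s : ℝ) t)
  rw [map_coe_timeMeasure] at h
  rw [intervalIntegrable_iff_integrableOn_Ioc_of_le (by exact_mod_cast hst)]
  rw [IntegrableOn, Measure.restrict_restrict measurableSet_Ioc, inter_eq_left.2
    (show Ioc (s : ℝ) t ⊆ Ici 0 from fun x hx => s.coe_nonneg.trans hx.1.le)] at h
  refine Iff.trans (iff_of_eq ?_) h.symm
  have : NNReal.toReal ⁻¹' Ioc (s : ℝ) t = Ioc s t := by ext x; simp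
  rw [this]
  congr! 1
  ext x; simp

theorem setIntegral_timeMeasure (g : ℝ≥0 → ℝ) {s t : ℝ≥0} (hst : s ≤ t) :
    ∫ u in Ioc s t, g u ∂timeMeasure = ∫ x in (s : ℝ)..t, g x.toNNReal := by
  have h := measurableEmbedding_coe_nnreal.setIntegral_map (μ := timeMeasure)
    (fun x : ℝ => g x.toNNReal) (Ioc (s : ℝ) t)
  rw [map_coe_timeMeasure, Measure.restrict_restrict measurableSet_Ioc, inter_eq_left.2
    (show Ioc (s : ℝ) t ⊆ Ici 0 from fun x hx => s.coe_nonneg.trans hx.1.le)] at h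
  rw [intervalIntegral.integral_of_le (by exact_mod_cast hst), h]
  have : NNReal.toReal ⁻¹' Ioc (s : ℝ) t = Ioc s t := by ext x; simp
  rw [this]
  simp

/-- `w` is a primitive of `h` in a neighbourhood of `r`. -/
def IsPrimitiveAt (w h : ℝ≥0 → ℝ) (r : ℝ≥0) : Prop :=
  ∃ U ∈ 𝓝 r, ∀ s ∈ U, ∀ t ∈ U, s ≤ t →
    IntegrableOn h (Ioc s t) timeMeasure ∧ w t = w s + ∫ u in Ioc s t, h u ∂timeMeasure

theorem integral_Ioc_add {h : ℝ≥0 → ℝ} {a b c : ℝ≥0} (hab : a ≤ b) (hbc : b ≤ c)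
    (h1 : IntegrableOn h (Ioc a b) timeMeasure) (h2 : IntegrableOn h (Ioc b c) timeMeasure) :
    IntegrableOn h (Ioc a c) timeMeasure ∧ ∫ u in Ioc a c, h u ∂timeMeasure =
      ∫ u in Ioc a b, h u ∂timeMeasure + ∫ u in Ioc b c, h u ∂timeMeasure := by
  rw [← Ioc_union_Ioc_eq_Ioc hab hbc]
  exact ⟨h1.union h2, setIntegral_union (Ioc_disjoint_Ioc_of_le le_rfl) measurableSet_Ioc h1 h2⟩

theorem eq_add_integral_of_isPrimitiveAt {w h : ℝ≥0 → ℝ} {s t : ℝ≥0} (hst : s ≤ t)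
    (H : ∀ r, s ≤ r → r ≤ t → IsPrimitiveAt w h r) :
    IntegrableOn h (Ioc s t) timeMeasure ∧ w t = w s + ∫ u in Ioc s t, h u ∂timeMeasure := by
  refine rel_of_locally_rel (R := fun s t => IntegrableOn h (Ioc s t) timeMeasure ∧
    w t = w s + ∫ u in Ioc s t, h u ∂timeMeasure) ?_ hst fun r h1 h2 => ?_
  · intro a b c hab hbc h1 h2
    have := integral_Ioc_add hab hbc h1.1 h2.1
    exact ⟨this.1, by rw [this.2, h2.2, h1.2]; ring⟩
  · obtain ⟨U, hU, h⟩ := H r h1 h2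
    exact ⟨U, hU, fun a ha b hb _ hab _ => h a ha b hb hab⟩

theorem IsPrimitiveAt.exists_Icc {w h : ℝ≥0 → ℝ} {r : ℝ≥0} (H : IsPrimitiveAt w h r) :
    ∃ s t, s ≤ t ∧ Icc s t ∈ 𝓝 r ∧ IntervalIntegrable (fun x : ℝ => h x.toNNReal) volume s t ∧
      ∀ y ∈ Icc (s : ℝ) t, w y.toNNReal = w s + ∫ x in (s : ℝ)..y, h x.toNNReal := by
  obtain ⟨U, hU, H⟩ := H
  obtain ⟨s, t, hr, hn, hsub⟩ := exists_Icc_mem_subset_of_mem_nhds hU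
  have hst := hr.1.trans hr.2
  refine ⟨s, t, hst, hn, ?_, fun y hy => ?_⟩
  · rw [← integrableOn_timeMeasure_iff _ hst]
    exact (H s (hsub ⟨le_rfl, hst⟩) t (hsub ⟨hst, le_rfl⟩) hst).1
  · have hy0 : 0 ≤ y := s.2.trans hy.1
    lift y to ℝ≥0 using hy0
    have h1 : s ≤ y := by exact_mod_cast hy.1
    have h2 : y ≤ t := by exact_mod_cast hy.2
    rw [Real.toNNReal_coe, ← setIntegral_timeMeasure _ h1]
    exact (H s (hsub ⟨le_rfl, hst⟩) y (hsub ⟨h1, h2⟩) h1).2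

theorem IsPrimitiveAt.continuousAt {w h : ℝ≥0 → ℝ} {r : ℝ≥0} (H : IsPrimitiveAt w h r) :
    ContinuousAt w r := by
  obtain ⟨s, t, hst, hn, hint, heq⟩ := H.exists_Icc
  refine ContinuousOn.continuousAt (s := Icc s t) ?_ hn
  have hst' : (s : ℝ) ≤ t := by exact_mod_cast hst
  have h1 : ContinuousOn (fun y : ℝ => w s + ∫ x in (s : ℝ)..y, h x.toNNReal) (Icc (s : ℝ) t) := by
    refine continuousOn_const.add ?_
    have := intervalIntegral.continuousOn_primitive_interval (a := (s : ℝ)) (b := t)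
      (f := fun x : ℝ => h x.toNNReal) (μ := volume)
      ((intervalIntegrable_iff' (by simp)).1 hint)
    rwa [uIcc_of_le hst'] at this
  have h2 : MapsTo ((↑) : ℝ≥0 → ℝ) (Icc s t) (Icc (s : ℝ) t) := fun y hy =>
    ⟨by exact_mod_cast hy.1, by exact_mod_cast hy.2⟩
  refine (h1.comp NNReal.continuous_coe.continuousOn h2).congr fun y hy => ?_
  have := heq y (h2 hy)
  rwa [Real.toNNReal_coe] at this

theorem IsPrimitiveAt.ae_deriv_eq {w h : ℝ≥0 → ℝ} {r : ℝ≥0} (H : IsPrimitiveAt w h r) :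
    ∃ V ∈ 𝓝 r, ∀ᵐ x ∂timeMeasure, x ∈ V → deriv (fun y : ℝ => w y.toNNReal) x = h x := by
  obtain ⟨s, t, hst, hn, hint, heq⟩ := H.exists_Icc
  have hst' : (s : ℝ) ≤ t := by exact_mod_cast hst
  refine ⟨Icc s t, hn, ?_⟩
  have h1 := hint.ae_hasDerivAt_integral
  have h2 : ∀ᵐ x ∂timeMeasure.map ((↑) : ℝ≥0 → ℝ), x ∈ uIcc (s : ℝ) t → ∀ c ∈ uIcc (s : ℝ) t,
      HasDerivAt (fun x => ∫ u in c..x, h u.toNNReal) (h x.toNNReal) x := by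
    rw [map_coe_timeMeasure]
    exact ae_restrict_of_ae h1
  have h3 := ae_of_ae_map measurableEmbedding_coe_nnreal.measurable.aemeasurable h2
  -- The endpoints are discarded because the formula for `w` must hold on both sides of `x` to be
  -- differentiated.
  filter_upwards [h3, compl_mem_ae_iff.2 (measure_singleton (μ := timeMeasure) s),
    compl_mem_ae_iff.2 (measure_singleton (μ := timeMeasure) t)] with x hx hxs hxt hxI
  rw [uIcc_of_le hst'] at hx
  have hxI' : (x : ℝ) ∈ Ioo (s : ℝ) t :=
    ⟨by exact_mod_cast lt_of_le_of_ne hxI.1 (Ne.symm hxs), by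
      exact_mod_cast lt_of_le_of_ne hxI.2 hxt⟩
  have := (hx (Ioo_subset_Icc_self hxI') s ⟨le_rfl, hst'⟩).const_add (w s)
  rw [Real.toNNReal_coe] at this
  refine (this.congr_of_eventuallyEq ?_).deriv
  filter_upwards [Icc_mem_nhds hxI'.1 hxI'.2] with y hy using heq y hy


/-! ### Jump times of a step path. -/

/-- The jump times of a path. -/
def jumps {α : Type*} [TopologicalSpace α] (x : ℝ≥0 → α) : Set ℝ≥0 :=
  {s | Function.leftLim x s ≠ x s}

/-- The counting measure of the jump times of a path. -/
noncomputable def jumpMeasure {α : Type*} [TopologicalSpace α] (x : ℝ≥0 → α) : Measure ℝ≥0 :=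
  Measure.count.restrict (jumps x)

/-- At the least time the left limit defaults to the value, so `0` never counts as a jump time. -/
theorem leftLim_zero {α : Type*} [TopologicalSpace α] (x : ℝ≥0 → α) :
    Function.leftLim x 0 = x 0 :=
  leftLim_eq_of_isBot fun _ => zero_le

theorem zero_notMem_jumps {α : Type*} [TopologicalSpace α] (x : ℝ≥0 → α) : 0 ∉ jumps x := by
  simp [jumps, leftLim_zero]

theorem leftLim_eq_of_const {α : Type*} [TopologicalSpace α] [T2Space α] {x : ℝ≥0 → α}
    {a b : ℝ≥0} (hab : a < b) {i : α} (h : ∀ s ∈ Ico a b, x s = i) : Function.leftLim x b = i := by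
  have : (𝓝[<] b).NeBot := nhdsLT_neBot_of_exists_lt ⟨a, hab⟩
  refine leftLim_eq_of_tendsto (tendsto_const_nhds.congr' ?_)
  filter_upwards [Ico_mem_nhdsLT hab] with s hs using (h s hs).symm

namespace IsStepPath

variable {α : Type*} [TopologicalSpace α] [DiscreteTopology α] {x : ℝ≥0 → α}

theorem exists_nhds (hx : IsStepPath x) (r : ℝ≥0) : ∃ U ∈ 𝓝 r, OrdConnected U ∧
    (∀ y ∈ U, y < r → x y = Function.leftLim x r) ∧ ∀ y ∈ U, r ≤ y → x y = x r := by
  obtain ⟨i, hi⟩ : ∃ i, ∀ᶠ s in 𝓝[<] r, x s = i := by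
    rcases eq_zero_or_pos r with rfl | h
    · exact ⟨x 0, by simp⟩
    · exact hx.leftLimits r h
  have h2 := hx.rightCts r
  have h3 := hi
  rw [eventually_nhdsWithin_iff] at hi h2
  obtain ⟨a, b, -, hn, hsub⟩ := exists_Icc_mem_subset_of_mem_nhds (hi.and h2)
  refine ⟨Icc a b, hn, ordConnected_Icc, fun y hy hyr => ?_, fun y hy hry => ?_⟩
  · have : (𝓝[<] r).NeBot := nhdsLT_neBot_of_exists_lt ⟨y, hyr⟩
    rw [(hsub hy).1 hyr]
    exact (leftLim_eq_of_tendsto (tendsto_const_nhds.congr' (h3.mono fun s hs => hs.symm))).symm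
  · rcases hry.eq_or_lt with rfl | h
    · rfl
    · exact (hsub hy).2 h

theorem eventually_eq_of_notMem_jumps (hx : IsStepPath x) {r : ℝ≥0} (hr : r ∉ jumps x) :
    ∀ᶠ s in 𝓝 r, x s = x r := by
  obtain ⟨U, hU, -, h1, h2⟩ := hx.exists_nhds r
  have hr' : Function.leftLim x r = x r := by simpa [jumps] using hr
  filter_upwards [hU] with s hs
  rcases lt_or_ge s r with h | h
  · rw [h1 s hs h, hr']
  · exact h2 s hs h

theorem notMem_jumps_of_const {a b : ℝ≥0} (hab : ∀ s ∈ Ico a b, x s = x a) {s : ℝ≥0}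
    (has : a < s) (hsb : s < b) : s ∉ jumps x := by
  simp only [jumps, mem_ofPred_eq, not_not]
  rw [leftLim_eq_of_const has fun u hu => hab u ⟨hu.1, hu.2.trans hsb⟩, hab s ⟨has.le, hsb⟩]

theorem jumps_inter_Ioc_of_const {a b : ℝ≥0} (hab : a < b) (h : ∀ s ∈ Ico a b, x s = x a) :
    jumps x ∩ Ioc a b = {s | s = b ∧ x a ≠ x b} := by
  ext s
  simp only [mem_inter_iff, mem_Ioc, mem_ofPred_eq]
  constructor
  · rintro ⟨hs, has, hsb⟩
    rcases hsb.eq_or_lt with rfl | hsb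
    · refine ⟨rfl, ?_⟩
      rw [← leftLim_eq_of_const has h]
      exact hs
    · exact absurd hs (notMem_jumps_of_const h has hsb)
  · rintro ⟨rfl, hne⟩
    refine ⟨?_, hab, le_rfl⟩
    rw [← leftLim_eq_of_const hab h] at hne
    exact hne

theorem finite_jumps (hx : IsStepPath x) (a b : ℝ≥0) : (jumps x ∩ Ioc a b).Finite := by
  rcases le_total b a with h | h
  · simp [Ioc_eq_empty_of_le h]
  refine hx.rel_of_rel_of_const (R := fun a b => (jumps x ∩ Ioc a b).Finite) (by simp) ?_ ?_ h
  · intro a b c hab hbc h1 h2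
    rw [← Ioc_union_Ioc_eq_Ioc hab hbc, inter_union_distrib_left]
    exact h1.union h2
  · intro a b hab h
    rw [jumps_inter_Ioc_of_const hab h]
    exact (finite_singleton b).subset fun s hs => hs.1

theorem countable_jumps (hx : IsStepPath x) : (jumps x).Countable := by
  have : jumps x ⊆ ⋃ n : ℕ, jumps x ∩ Ioc 0 (n : ℝ≥0) := fun s hs => by
    obtain ⟨n, hn⟩ := exists_nat_ge s
    refine mem_iUnion.2 ⟨n, hs, pos_iff_ne_zero.2 ?_, hn⟩
    rintro rfl
    exact zero_notMem_jumps x hs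
  exact (countable_iUnion fun n : ℕ => (hx.finite_jumps 0 n).countable).mono this

theorem timeMeasure_jumps (hx : IsStepPath x) : timeMeasure (jumps x) = 0 :=
  hx.countable_jumps.measure_zero _

theorem measurableSet_jumps (hx : IsStepPath x) : MeasurableSet (jumps x) :=
  hx.countable_jumps.measurableSet

theorem ae_leftLim_eq (hx : IsStepPath x) : ∀ᵐ s ∂timeMeasure, Function.leftLim x s = x s := by
  rw [ae_iff]
  exact hx.timeMeasure_jumps

theorem isFiniteMeasure_jumpMeasure (hx : IsStepPath x) (a b : ℝ≥0) :
    IsFiniteMeasure ((jumpMeasure x).restrict (Ioc a b)) where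
  measure_univ_lt_top := by
    rw [jumpMeasure, Measure.restrict_apply_univ, Measure.restrict_apply' hx.measurableSet_jumps,
      Measure.count_apply_lt_top, inter_comm]
    exact hx.finite_jumps a b

theorem jumpMeasure_eq_zero_iff (hx : IsStepPath x) (A : Set ℝ≥0) :
    jumpMeasure x A = 0 ↔ ∀ s ∈ A, s ∉ jumps x := by
  rw [jumpMeasure, Measure.restrict_apply' hx.measurableSet_jumps, Measure.count_eq_zero_iff]
  exact disjoint_iff_inter_eq_empty.symm.trans disjoint_left

open Classical in
theorem jumpMeasure_Ioc_of_const (hx : IsStepPath x) {a b : ℝ≥0} (hab : a < b)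
    (h : ∀ s ∈ Ico a b, x s = x a) (S : Set ℝ≥0) :
    jumpMeasure x (Ioc a b ∩ S) = if x a = x b ∨ b ∉ S then 0 else 1 := by
  rw [jumpMeasure, Measure.restrict_apply' hx.measurableSet_jumps, inter_comm, ← inter_assoc,
    jumps_inter_Ioc_of_const hab h]
  split_ifs with hS
  · rw [Measure.count_eq_zero_iff, eq_empty_iff_forall_notMem]
    rintro s ⟨⟨rfl, h1⟩, h2⟩
    tauto
  · push Not at hS
    rw [show ({s | s = b ∧ x a ≠ x b} ∩ S : Set ℝ≥0) = {b} by
      ext s; constructor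
      · exact fun h => h.1.1
      · rintro rfl; exact ⟨⟨rfl, hS.1⟩, hS.2⟩, Measure.count_singleton]

/-- `S` may be any set: the jump times are countable, so all their subsets are measurable. -/
theorem jumpMeasure_Ioc_add {a b c : ℝ≥0} (hx : IsStepPath x) (hab : a ≤ b) (hbc : b ≤ c)
    (S : Set ℝ≥0) : jumpMeasure x (Ioc a c ∩ S) =
      jumpMeasure x (Ioc a b ∩ S) + jumpMeasure x (Ioc b c ∩ S) := by
  rw [← Ioc_union_Ioc_eq_Ioc hab hbc, union_inter_distrib_right, jumpMeasure]
  simp only [Measure.restrict_apply' hx.measurableSet_jumps]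
  rw [union_inter_distrib_right, measure_union]
  · exact (Ioc_disjoint_Ioc_of_le le_rfl).mono (fun s hs => hs.1.1) (fun s hs => hs.1.1)
  · refine ((hx.countable_jumps).mono fun s hs => hs.2).measurableSet

open Classical in
/-- Between two times a state is entered as often as it is left, up to the boundary terms. -/
theorem jumpMeasure_enter_leave (hx : IsStepPath x) {a b : ℝ≥0} (hab : a ≤ b) (k : α) :
    jumpMeasure x (Ioc a b ∩ {s | x s = k}) + (if x a = k then 1 else 0) =
      jumpMeasure x (Ioc a b ∩ {s | Function.leftLim x s = k}) + (if x b = k then 1 else 0) := by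
  refine hx.rel_of_rel_of_const (R := fun a b =>
    jumpMeasure x (Ioc a b ∩ {s | x s = k}) + (if x a = k then 1 else 0) =
      jumpMeasure x (Ioc a b ∩ {s | Function.leftLim x s = k}) + (if x b = k then 1 else 0))
    (by simp) ?_ ?_ hab
  · intro a b c hab hbc h1 h2
    rw [hx.jumpMeasure_Ioc_add hab hbc, hx.jumpMeasure_Ioc_add hab hbc, add_right_comm, h1,
      add_assoc _ _ (if x c = k then 1 else 0), ← h2]
    ring
  · intro a b hab h
    rw [hx.jumpMeasure_Ioc_of_const hab h, hx.jumpMeasure_Ioc_of_const hab h]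
    simp only [mem_ofPred_eq, leftLim_eq_of_const hab h]
    by_cases h1 : x a = x b
    · simp [h1]
    · by_cases h2 : x a = k
      · have h3 : ¬ x b = k := fun h => h1 (h2.trans h.symm)
        simp [h2, h3, show k ≠ x b from Ne.symm h3]
      · by_cases h3 : x b = k <;> simp [h1, h2, h3]

open Classical in
-- Each time has a neighbourhood with at most one jump; a Lebesgue number of this cover of `[0, t]`
-- is a mesh below which comparing the endpoints of an interval counts its jumps.
theorem exists_jumpMeasure_Ioc_eq (hx : IsStepPath x) (t : ℝ≥0) :
    ∃ δ > 0, ∀ a b, a ≤ b → b ≤ t → dist a b < δ →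
      jumpMeasure x (Ioc a b) = if x a = x b then 0 else 1 := by
  have loc : ∀ r, ∃ U, IsOpen U ∧ r ∈ U ∧ ∀ a ∈ U, ∀ b ∈ U, a ≤ b →
      jumpMeasure x (Ioc a b) = if x a = x b then 0 else 1 := by
    intro r
    obtain ⟨U, hU, hUo, h1, h2⟩ := hx.exists_nhds r
    refine ⟨interior U, isOpen_interior, mem_interior_iff_mem_nhds.2 hU, fun a ha b hb hab => ?_⟩
    replace ha := interior_subset ha
    replace hb := interior_subset hb
    rcases hab.eq_or_lt with rfl | hab
    · simp
    have key := fun {a b : ℝ≥0} (hab : a < b) h => hx.jumpMeasure_Ioc_of_const hab h univ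
    simp only [inter_univ, mem_univ, not_true_eq_false, or_false] at key
    rcases lt_or_ge a r with har | har
    · rcases lt_or_ge b r with hbr | hbr
      · exact key hab fun s hs => by
          rw [h1 a ha har, h1 s (hUo.out ha hb ⟨hs.1, hs.2.le⟩) (hs.2.trans hbr)]
      · have hr := mem_of_mem_nhds hU
        have e1 := key har fun s hs => by
          rw [h1 a ha har, h1 s (hUo.out ha hr ⟨hs.1, hs.2.le⟩) hs.2]
        have e2 : jumpMeasure x (Ioc r b) = 0 := by
          rcases hbr.eq_or_lt with rfl | hbr
          · simp
          · rw [key hbr fun s hs => h2 s (hUo.out hr hb ⟨hs.1, hs.2.le⟩) hs.1,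
              h2 b hb hbr.le, if_pos rfl]
        have e3 := hx.jumpMeasure_Ioc_add har.le hbr univ
        simp only [inter_univ] at e3
        rw [e3, e1, e2, add_zero, h2 b hb hbr]
    · exact key hab fun s hs => by
        rw [h2 a ha har, h2 s (hUo.out ha hb ⟨hs.1, hs.2.le⟩) (har.trans hs.1)]
  choose U hU hr h using loc
  obtain ⟨δ, hδ, hc⟩ := lebesgue_number_lemma_of_metric (isCompact_Icc : IsCompact (Icc 0 t))
    hU (fun r _ => mem_iUnion.2 ⟨r, hr r⟩)
  refine ⟨δ, hδ, fun a b hab hbt hd => ?_⟩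
  obtain ⟨i, hi⟩ := hc a ⟨zero_le, hab.trans hbt⟩
  exact h i a (hi (Metric.mem_ball_self hδ)) b (hi (by rwa [Metric.mem_ball, dist_comm])) hab

open Classical in
-- This exhibits the number of jumps as a limit of functions of finitely many values of the path. It
-- yields the measurability of that number and, through Fatou's lemma, a bound for its expectation.
theorem eventually_sum_eq_jumpMeasure (hx : IsStepPath x) (t : ℝ≥0) :
    ∀ᶠ n : ℕ in atTop, (∑ k ∈ Finset.range (n + 1), if x (t * (k / (n + 1))) =
      x (t * ((k + 1 : ℕ) / (n + 1))) then (0 : ℝ≥0∞) else 1) = jumpMeasure x (Ioc 0 t) := by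
  obtain ⟨δ, hδ, h⟩ := hx.exists_jumpMeasure_Ioc_eq t
  have hlim : Tendsto (fun n : ℕ => (t : ℝ) * (1 / ((n : ℝ) + 1))) atTop (𝓝 (t * 0)) :=
    tendsto_one_div_add_atTop_nhds_zero_nat.const_mul _
  rw [mul_zero] at hlim
  filter_upwards [hlim.eventually (gt_mem_nhds hδ)] with n hn
  have hmono : ∀ k : ℕ, t * ((k : ℝ≥0) / (n + 1)) ≤ t * ((k + 1 : ℕ) / (n + 1)) := fun k => by
    gcongr; simp
  have hsum : ∀ m : ℕ, ∑ k ∈ Finset.range m, jumpMeasure x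
      (Ioc (t * ((k : ℝ≥0) / (n + 1))) (t * ((k + 1 : ℕ) / (n + 1)))) =
      jumpMeasure x (Ioc 0 (t * (m / (n + 1)))) := by
    intro m
    induction m with
    | zero => simp
    | succ m ih =>
      have := hx.jumpMeasure_Ioc_add (zero_le (a := t * ((m : ℝ≥0) / (n + 1)))) (hmono m) univ
      simp only [inter_univ] at this
      rw [Finset.sum_range_succ, ih, this]
  have h1 : t * ((n + 1 : ℕ) / (n + 1)) = t := by
    push_cast
    rw [div_self (by positivity), mul_one]
  have := hsum (n + 1)
  rw [h1] at this
  rw [← this]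
  refine Finset.sum_congr rfl fun k hk => (h _ _ (hmono k) ?_ ?_).symm
  · have hk : ((k + 1 : ℕ) : ℝ≥0) ≤ (n + 1 : ℕ) := by exact_mod_cast Finset.mem_range.1 hk
    calc t * ((k + 1 : ℕ) / (n + 1)) ≤ t * ((n + 1 : ℕ) / (n + 1)) := by gcongr
      _ = t := h1
  · rw [NNReal.dist_eq]
    push_cast
    rw [show (t : ℝ) * (k / (n + 1)) - t * ((k + 1) / (n + 1)) = -(t * (1 / (n + 1))) by ring,
      abs_neg, abs_of_nonneg (by positivity)]
    exact hn

end IsStepPath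


/-! ### Joint measurability and predictability of step processes. -/

theorem tendsto_add_one_div_add_one (t : ℝ≥0) :
    Tendsto (fun n : ℕ => t + 1 / ((n : ℝ≥0) + 1)) atTop (𝓝 t) := by
  have : Tendsto (fun n : ℕ => 1 / ((n : ℝ≥0) + 1)) atTop (𝓝 0) := by
    rw [← NNReal.tendsto_coe]
    push_cast
    exact tendsto_one_div_add_atTop_nhds_zero_nat
  simpa using this.const_add t

theorem measurable_uncurry_min_of_rightCts {Ω : Type*} [MeasurableSpace Ω] {N : ℕ}
    {x : ℝ≥0 → Ω → Fin N} (T : ℝ≥0) (hm : ∀ t ≤ T, Measurable (x t))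
    (hr : ∀ ω t, ∀ᶠ s in 𝓝[>] t, x s ω = x t ω) :
    Measurable fun q : ℝ≥0 × Ω => x (min q.1 T) q.2 := by
  -- The first grid point strictly after `t`, capped at `T`: right continuity applies, and only
  -- values at times `≤ T` enter, which is what progressive measurability needs.
  let u : ℕ → ℝ≥0 → ℝ≥0 := fun n t => min ((⌊((n : ℝ≥0) + 1) * t⌋₊ + 1 : ℝ≥0) / (n + 1)) T
  have hlt : ∀ (n : ℕ) (t : ℝ≥0), t < ((⌊((n : ℝ≥0) + 1) * t⌋₊ + 1 : ℝ≥0) / (n + 1)) := by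
    intro n t
    rw [lt_div_iff₀ (by positivity), mul_comm]
    exact Nat.lt_floor_add_one _
  have hle : ∀ (n : ℕ) (t : ℝ≥0),
      ((⌊((n : ℝ≥0) + 1) * t⌋₊ + 1 : ℝ≥0) / (n + 1)) ≤ t + 1 / ((n : ℝ≥0) + 1) := by
    intro n t
    rw [add_div]
    gcongr
    rw [div_le_iff₀ (by positivity), mul_comm]
    exact Nat.floor_le zero_le
  refine measurable_of_tendsto_metrizable (f := fun n (q : ℝ≥0 × Ω) => x (u n q.1) q.2) ?_ ?_
  · intro n
    have h1 : Measurable fun p : ℕ × Ω => x (min (((p.1 : ℝ≥0) + 1) / (n + 1)) T) p.2 :=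
      measurable_from_prod_countable_right fun k =>
        hm (min (((k : ℝ≥0) + 1) / (n + 1)) T) (min_le_right _ _)
    have h2 : Measurable fun q : ℝ≥0 × Ω => ((n : ℝ≥0) + 1) * q.1 := by fun_prop
    have h3 : Measurable fun q : ℝ≥0 × Ω => (⌊((n : ℝ≥0) + 1) * q.1⌋₊, q.2) :=
      (Nat.measurable_floor.comp h2).prodMk measurable_snd
    simpa only [Function.comp_def] using h1.comp h3
  · rw [tendsto_pi_nhds]
    rintro ⟨t, ω⟩
    refine tendsto_const_nhds.congr' ?_
    rcases lt_or_ge t T with h | h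
    · have h1 : Tendsto (fun n => u n t) atTop (𝓝[>] t) := by
        refine tendsto_nhdsWithin_iff.2 ⟨?_, Eventually.of_forall fun n => lt_min (hlt n t) h⟩
        refine tendsto_of_tendsto_of_tendsto_of_le_of_le tendsto_const_nhds
          (tendsto_add_one_div_add_one t) (fun n => (lt_min (hlt n t) h).le)
          (fun n => (min_le_left _ _).trans (hle n t))
      filter_upwards [h1.eventually (hr ω t)] with n hn
      rw [min_eq_left h.le]
      exact hn.symm
    · refine Eventually.of_forall fun n => ?_
      simp only [u]
      rw [min_eq_right h, min_eq_right (h.trans (hlt n t).le)]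

theorem measurable_uncurry_Iic_of_rightCts {Ω : Type*} [MeasurableSpace Ω] {N : ℕ}
    {x : ℝ≥0 → Ω → Fin N} (T : ℝ≥0) (hm : ∀ t ≤ T, Measurable (x t))
    (hr : ∀ ω t, ∀ᶠ s in 𝓝[>] t, x s ω = x t ω) :
    Measurable fun q : Iic T × Ω => x q.1 q.2 := by
  have := (measurable_uncurry_min_of_rightCts T hm hr).comp
    ((measurable_subtype_coe.comp measurable_fst).prodMk measurable_snd :
      Measurable fun q : Iic T × Ω => ((q.1 : ℝ≥0), q.2))
  convert this using 2 with q
  exact congrArg (fun t => x t q.2) (min_eq_left q.1.2).symm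

theorem measurable_uncurry_of_rightCts {Ω : Type*} [MeasurableSpace Ω] {N : ℕ}
    {x : ℝ≥0 → Ω → Fin N} (hm : ∀ t, Measurable (x t))
    (hr : ∀ ω t, ∀ᶠ s in 𝓝[>] t, x s ω = x t ω) :
    Measurable fun q : ℝ≥0 × Ω => x q.1 q.2 := by
  refine measurable_of_tendsto_metrizable
    (fun n : ℕ => measurable_uncurry_min_of_rightCts (n : ℝ≥0) (fun t _ => hm t) hr) ?_
  rw [tendsto_pi_nhds]
  rintro ⟨t, ω⟩
  obtain ⟨n, hn⟩ := exists_nat_ge t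
  refine tendsto_const_nhds.congr' ?_
  filter_upwards [eventually_ge_atTop n] with k hk
  rw [min_eq_left (hn.trans (by exact_mod_cast hk))]

theorem predictable_le {Ω : Type*} {m : MeasurableSpace Ω} (𝓕 : Filtration ℝ≥0 m) :
    𝓕.predictable ≤ (inferInstance : MeasurableSpace (ℝ≥0 × Ω)) :=
  measurableSpace_le_predictable_of_measurableSet
    (fun _ hA => (measurableSet_singleton _).prod (𝓕.le _ _ hA))
    (fun i _ hA => (measurableSet_Ioi : MeasurableSet (Ioi i)).prod (𝓕.le _ _ hA))

theorem measurable_fst_predictable {Ω : Type*} {m : MeasurableSpace Ω} (𝓕 : Filtration ℝ≥0 m) :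
    Measurable[𝓕.predictable] (Prod.fst : ℝ≥0 × Ω → ℝ≥0) := by
  let _ : MeasurableSpace (ℝ≥0 × Ω) := 𝓕.predictable
  refine measurable_of_Ioi fun a => ?_
  have : (Prod.fst : ℝ≥0 × Ω → ℝ≥0) ⁻¹' Ioi a = Ioi a ×ˢ univ := by ext; simp
  rw [this]
  exact measurableSet_predictable_Ioi_prod MeasurableSet.univ

theorem isStronglyPredictable_deterministic {Ω : Type*} {m : MeasurableSpace Ω}
    (𝓕 : Filtration ℝ≥0 m) {N : ℕ} {v : ℝ≥0 → Fin N → ℝ} (hv : Measurable v) :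
    IsStronglyPredictable 𝓕 (fun t (_ : Ω) => v t) :=
  (hv.comp (measurable_fst_predictable 𝓕)).stronglyMeasurable

/-- The left limits of an adapted step process are predictable. -/
theorem measurable_leftLim_predictable {Ω : Type*} {m : MeasurableSpace Ω} (𝓕 : Filtration ℝ≥0 m)
    {N : ℕ} {x : ℝ≥0 → Ω → Fin N} (hm : ∀ t, Measurable[𝓕 t] (x t))
    (hx : ∀ ω, IsStepPath fun t => x t ω) :
    Measurable[𝓕.predictable]
      (fun q : ℝ≥0 × Ω => Function.leftLim (fun s => x s q.2) q.1) := by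
  -- The last grid point strictly before `t`. At `t = 0` truncated subtraction gives `0`, in
  -- agreement with the left limit there.
  let u : ℕ → ℝ≥0 → ℝ≥0 := fun n t => ((⌈((n : ℝ≥0) + 1) * t⌉₊ - 1 : ℕ) : ℝ≥0) / (n + 1)
  refine @measurable_of_tendsto_metrizable _ _ 𝓕.predictable _ _ _ _
    (fun n (q : ℝ≥0 × Ω) => x (u n q.1) q.2) _ ?_ ?_
  · intro n
    refine @measurable_to_countable' _ _ _ _ 𝓕.predictable _ fun i => ?_
    have : (fun q : ℝ≥0 × Ω => x (u n q.1) q.2) ⁻¹' {i} = {⊥} ×ˢ (x ⊥ ⁻¹' {i}) ∪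
        ⋃ k : ℕ, Ioc ((k : ℝ≥0) / (n + 1)) (((k + 1 : ℕ) : ℝ≥0) / (n + 1)) ×ˢ
          (x ((k : ℝ≥0) / (n + 1)) ⁻¹' {i}) := by
      have hiff : ∀ (k : ℕ) (t : ℝ≥0),
          t ∈ Ioc ((k : ℝ≥0) / (n + 1)) (((k + 1 : ℕ) : ℝ≥0) / (n + 1)) ↔
            ⌈((n : ℝ≥0) + 1) * t⌉₊ = k + 1 := by
        intro k t
        rw [Nat.ceil_eq_iff (by simp), mem_Ioc, div_lt_iff₀ (by positivity),
          le_div_iff₀ (by positivity), mul_comm t]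
        simp
      ext ⟨t, ω⟩
      simp only [mem_preimage, mem_singleton_iff, mem_union, mem_iUnion, mem_prod, hiff]
      rcases Nat.eq_zero_or_pos ⌈((n : ℝ≥0) + 1) * t⌉₊ with h | h
      · have ht : t = 0 := by
          rw [Nat.ceil_eq_zero] at h
          rcases mul_eq_zero.1 (le_antisymm h zero_le) with h | h
          · exact absurd h (by positivity)
          · exact h
        subst ht
        simp [u]
      · have ht : t ≠ ⊥ := by
          rintro rfl
          simp at h
        obtain ⟨k, hk⟩ := Nat.exists_eq_add_of_le' h
        simp only [ht, false_and, false_or, u, hk, Nat.add_sub_cancel]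
        constructor
        · exact fun h => ⟨k, rfl, h⟩
        · rintro ⟨l, hl, h⟩
          obtain rfl : k = l := by omega
          exact h
    rw [this]
    refine @MeasurableSet.union _ 𝓕.predictable _ _ (measurableSet_predictable_singleton_bot_prod
      (hm ⊥ (measurableSet_singleton i))) (@MeasurableSet.iUnion _ _ 𝓕.predictable _ _ fun k =>
        measurableSet_predictable_Ioc_prod _ _ (hm _ (measurableSet_singleton i)))
  · rw [tendsto_pi_nhds]
    rintro ⟨t, ω⟩
    refine tendsto_const_nhds.congr' ?_
    rcases eq_zero_or_pos t with rfl | ht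
    · refine Eventually.of_forall fun n => ?_
      simp [u, leftLim_zero]
    · have hu : ∀ n : ℕ, u n t < t ∧ t ≤ u n t + 1 / (n + 1) := by
        intro n
        have hpos : 0 < ⌈((n : ℝ≥0) + 1) * t⌉₊ := Nat.ceil_pos.2 (by positivity)
        obtain ⟨k, hk⟩ := Nat.exists_eq_add_of_le' hpos
        have hk' := (Nat.ceil_eq_iff (by simp)).1 hk
        simp only [u, hk, Nat.add_sub_cancel]
        rw [← add_div, div_lt_iff₀ (by positivity), le_div_iff₀ (by positivity), mul_comm t]
        simpa using hk'
      have h1 : Tendsto (fun n => u n t) atTop (𝓝[<] t) := by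
        refine tendsto_nhdsWithin_iff.2 ⟨?_, Eventually.of_forall fun n => (hu n).1⟩
        have hl : Tendsto (fun n : ℕ => t - 1 / ((n : ℝ≥0) + 1)) atTop (𝓝 t) := by
          have : Tendsto (fun n : ℕ => 1 / ((n : ℝ≥0) + 1)) atTop (𝓝 0) := by
            simpa using tendsto_add_one_div_add_one 0
          simpa using this.const_sub t
        exact tendsto_of_tendsto_of_tendsto_of_le_of_le hl tendsto_const_nhds
          (fun n => tsub_le_iff_right.2 (hu n).2) (fun n => (hu n).1.le)
      obtain ⟨U, hU, -, h2, -⟩ := (hx ω).exists_nhds t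
      filter_upwards [h1 (mem_nhdsWithin_of_mem_nhds hU)] with n hn
      exact (h2 _ hn (hu n).1).symm

namespace MarkovChain

variable {Ω : Type*} [m : MeasurableSpace Ω] {P : Measure Ω} {N : ℕ} (C : MarkovChain P N)

theorem isStepPath (ω : Ω) : IsStepPath fun t => C.X t ω := ⟨C.rightCts ω, C.leftLimits ω⟩

/-- The left limit of the chain. -/
noncomputable def Xleft (t : ℝ≥0) (ω : Ω) : Fin N := Function.leftLim (fun s => C.X s ω) t

theorem adapted_X (t : ℝ≥0) : Measurable[C.ℱ t] (C.X t) := by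
  refine measurable_iff_comap_le.2 (le_sup_of_le_left ?_)
  exact le_iSup₂_of_le (f := fun s (_ : s ≤ t) => MeasurableSpace.comap (C.X s) inferInstance)
    t le_rfl le_rfl

theorem adapted_X_of_le {s t : ℝ≥0} (h : s ≤ t) : Measurable[C.ℱ t] (C.X s) :=
  (C.adapted_X s).mono (C.ℱ.mono h) le_rfl

theorem measurable_uncurry_X : Measurable fun q : ℝ≥0 × Ω => C.X q.1 q.2 :=
  measurable_uncurry_of_rightCts C.measurable_X C.rightCts

theorem measurable_Xleft_predictable :
    Measurable[C.ℱ.predictable] fun q : ℝ≥0 × Ω => C.Xleft q.1 q.2 :=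
  measurable_leftLim_predictable C.ℱ C.adapted_X C.isStepPath

theorem measurable_Xleft : Measurable fun q : ℝ≥0 × Ω => C.Xleft q.1 q.2 :=
  C.measurable_Xleft_predictable.mono (predictable_le _) le_rfl

theorem progressive_X (T : ℝ≥0) :
    Measurable[Subtype.instMeasurableSpace.prod (C.ℱ T)] fun q : Iic T × Ω => C.X q.1 q.2 :=
  @measurable_uncurry_Iic_of_rightCts Ω (C.ℱ T) N C.X T
    (fun _ ht => C.adapted_X_of_le ht) C.rightCts

end MarkovChain

/-! ### The forward equation and the expected number of jumps. -/

namespace MarkovChain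

variable {Ω : Type*} [m : MeasurableSpace Ω] {P : Measure Ω} {N : ℕ} (C : MarkovChain P N)

theorem measurableSet_X (t : ℝ≥0) (i : Fin N) : MeasurableSet {ω | C.X t ω = i} :=
  C.measurable_X t (measurableSet_singleton i)

theorem measurable_A_Xleft (k : Fin N) :
    Measurable fun q : ℝ≥0 × Ω => C.A q.1 k (C.Xleft q.1 q.2) := by
  have h1 : Measurable fun p : Fin N × ℝ≥0 => C.A p.2 k p.1 :=
    measurable_from_prod_countable_right fun j => C.isRateMatrix.measurable k j
  exact h1.comp (C.measurable_Xleft.prodMk measurable_fst)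

theorem integrableOn_forward {p : ℝ≥0 → ℝ≥0 → Matrix (Fin N) (Fin N) ℝ}
    (hp : IsTransitionFunction C.A p) (a b : ℝ≥0) (k j i : Fin N) :
    IntegrableOn (fun u => C.A u k j * p a u j i) (Ioc a b) timeMeasure := by
  obtain ⟨K, hK⟩ := C.isRateMatrix.bounded
  have h1 : IntegrableOn (fun u => p a u j i) (Ioc a b) timeMeasure :=
    (((hp.continuousOn a j i).mono Icc_subset_Ici_self).integrableOn_compact
      isCompact_Icc).mono_set Ioc_subset_Icc_self
  exact h1.bdd_mul (c := K) (C.isRateMatrix.measurable k j).aestronglyMeasurable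
    (ae_of_all _ fun u => hK u k j)

theorem measurable_ite_X_eq (a b : ℝ≥0) :
    Measurable fun ω => if C.X a ω = C.X b ω then (0 : ℝ≥0∞) else 1 :=
  Measurable.ite (measurableSet_eq_fun (C.measurable_X a) (C.measurable_X b))
    measurable_const measurable_const

theorem measurable_jumpMeasure_Ioc (t : ℝ≥0) :
    Measurable fun ω => jumpMeasure (fun s => C.X s ω) (Ioc 0 t) := by
  refine measurable_of_tendsto_metrizable (f := fun (n : ℕ) ω =>
    ∑ k ∈ Finset.range (n + 1), if C.X (t * (k / (n + 1))) ω =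
      C.X (t * ((k + 1 : ℕ) / (n + 1))) ω then (0 : ℝ≥0∞) else 1) (fun n => ?_) ?_
  · exact Finset.measurable_sum _ fun k _ => C.measurable_ite_X_eq _ _
  · rw [tendsto_pi_nhds]
    intro ω
    refine tendsto_const_nhds.congr' ?_
    filter_upwards [(C.isStepPath ω).eventually_sum_eq_jumpMeasure t] with n hn
    convert hn.symm

variable [IsProbabilityMeasure P]

theorem setIntegral_comp_X (F : Set Ω) (t : ℝ≥0) (g : Fin N → ℝ) :
    ∫ ω in F, g (C.X t ω) ∂P = ∑ j, g j * P.real (F ∩ {ω | C.X t ω = j}) := by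
  classical
  have h1 : ∀ ω, g (C.X t ω) = ∑ j, {ω | C.X t ω = j}.indicator (fun _ => g j) ω := by
    intro ω
    simp [indicator_apply]
  simp_rw [h1]
  rw [integral_finsetSum]
  · refine Finset.sum_congr rfl fun j _ => ?_
    rw [integral_indicator (C.measurableSet_X t j), Measure.restrict_restrict
      (C.measurableSet_X t j), setIntegral_const, inter_comm, smul_eq_mul, mul_comm]
  · intro j _
    exact (integrable_const (g j)).indicator (C.measurableSet_X t j)

theorem measureReal_inter_X_of_markov {p : ℝ≥0 → ℝ≥0 → Matrix (Fin N) (Fin N) ℝ}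
    (hp : ∀ s t, s ≤ t → ∀ i,
      P[fun ω => e (C.X t ω) i | augmentedFiltration P C.X C.measurable_X s]
        =ᵐ[P] fun ω => p s t i (C.X s ω))
    {a t : ℝ≥0} (hat : a ≤ t) {F : Set Ω} (hF : MeasurableSet[C.ℱ a] F) (k : Fin N) :
    P.real (F ∩ {ω | C.X t ω = k}) = ∑ i, p a t k i * P.real (F ∩ {ω | C.X a ω = i}) := by
  classical
  have hF' := C.ℱ.le a _ hF
  have h1 : Integrable (fun ω => e (C.X t ω) k) P := by
    refine Integrable.of_bound (C := 1) ?_ (ae_of_all _ fun ω => ?_)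
    · exact ((measurable_of_countable fun j : Fin N => e j k).comp
        (C.measurable_X t)).aestronglyMeasurable
    · simp only [e, Pi.single_apply]
      split_ifs <;> simp
  have h2 := setIntegral_condExp (C.ℱ.le a) h1 hF
  change ∫ x in F, (P[fun ω => e (C.X t ω) k | augmentedFiltration P C.X C.measurable_X a]) x ∂P = _
    at h2
  rw [setIntegral_congr_ae hF' ((hp a t hat k).mono fun ω h _ => h),
    C.setIntegral_comp_X F a (fun i => p a t k i),
    C.setIntegral_comp_X F t (fun j => e j k)] at h2
  rw [h2]
  simp [e, Pi.single_apply]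

/-- Kolmogorov's forward equation for the law of the chain on an event of the past. -/
theorem measureReal_inter_X {a b : ℝ≥0} (hab : a ≤ b) {F : Set Ω} (hF : MeasurableSet[C.ℱ a] F)
    (k : Fin N) : P.real (F ∩ {ω | C.X b ω = k}) = P.real (F ∩ {ω | C.X a ω = k}) +
      ∫ u in Ioc a b, (∑ j, C.A u k j * P.real (F ∩ {ω | C.X u ω = j})) ∂timeMeasure := by
  obtain ⟨p, hp, hm⟩ := C.markov
  have h1 : ∫ u in Ioc a b, (∑ j, C.A u k j * P.real (F ∩ {ω | C.X u ω = j})) ∂timeMeasure =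
      ∫ u in Ioc a b, ∑ i, (C.A u * p a u) k i * P.real (F ∩ {ω | C.X a ω = i}) ∂timeMeasure := by
    refine setIntegral_congr_fun measurableSet_Ioc fun u hu => ?_
    simp only [Matrix.mul_apply]
    simp_rw [C.measureReal_inter_X_of_markov hm hu.1.le hF, Finset.mul_sum, Finset.sum_mul]
    rw [Finset.sum_comm]
    simp only [mul_assoc]
  have h2 : ∀ i, IntegrableOn (fun u => (C.A u * p a u) k i) (Ioc a b) timeMeasure := fun i => by
    simp only [Matrix.mul_apply]
    exact integrable_finsetSum _ fun j _ => C.integrableOn_forward hp a b k j i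
  rw [h1, C.measureReal_inter_X_of_markov hm hab hF, integral_finsetSum _
    fun i _ => (h2 i).mul_const _]
  simp_rw [hp.forward a b hab, integral_mul_const, add_mul, Finset.sum_add_distrib]
  simp [Matrix.one_apply]

/-- Apply the forward equation on the past event `X_a = i`: with bounded rates, the probability of
still being in `i` at time `b` drops by at most a multiple of `b - a`. Then sum over `i`. -/
theorem exists_measureReal_ne_le : ∃ K : ℝ≥0, ∀ a b, a ≤ b →
    P {ω | C.X a ω ≠ C.X b ω} ≤ ENNReal.ofReal (K * (b - a)) := by
  obtain ⟨K, hK⟩ := C.isRateMatrix.bounded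
  have key : ∀ a b, a ≤ b → ∀ i, P.real ({ω | C.X a ω = i} \ {ω | C.X b ω = i}) ≤
      N * |K| * (b - a) := by
    intro a b hab i
    have h1 := C.measureReal_inter_X hab (C.adapted_X a (measurableSet_singleton i)) i
    have h2 := measureReal_inter_add_sdiff (μ := P) (s := {ω | C.X a ω = i})
      (C.measurableSet_X b i)
    have h3 : ‖∫ u in Ioc a b, (∑ j, C.A u i j *
        P.real (C.X a ⁻¹' {i} ∩ {ω | C.X u ω = j})) ∂timeMeasure‖ ≤
        N * |K| * timeMeasure.real (Ioc a b) := by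
      refine norm_setIntegral_le_of_norm_le_const (by rw [timeMeasure_Ioc]; simp) fun u _ => ?_
      refine (norm_sum_le _ _).trans ?_
      calc ∑ j, ‖C.A u i j * P.real (C.X a ⁻¹' {i} ∩ {ω | C.X u ω = j})‖
          ≤ ∑ j : Fin N, |K| := by
            refine Finset.sum_le_sum fun j _ => ?_
            rw [norm_mul, Real.norm_eq_abs, Real.norm_eq_abs, abs_of_nonneg measureReal_nonneg]
            calc _ ≤ |K| * 1 := by
                  exact mul_le_mul ((hK u i j).trans (le_abs_self K)) measureReal_le_one
                    measureReal_nonneg (abs_nonneg K)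
              _ = _ := mul_one _
        _ = N * |K| := by simp
    rw [measureReal_def, timeMeasure_Ioc, ENNReal.toReal_ofReal
      (sub_nonneg.2 (by exact_mod_cast hab)), Real.norm_eq_abs] at h3
    have h4 := neg_le_of_abs_le h3
    have h5 : C.X a ⁻¹' {i} ∩ {ω | C.X a ω = i} = {ω | C.X a ω = i} := by ext; simp
    have h6 : C.X a ⁻¹' {i} = {ω | C.X a ω = i} := rfl
    rw [h5] at h1
    rw [h6] at h1 h4
    linarith
  refine ⟨(N * (N * |K|)).toNNReal, fun a b hab => ?_⟩
  have h1 : {ω | C.X a ω ≠ C.X b ω} ⊆ ⋃ i, ({ω | C.X a ω = i} \ {ω | C.X b ω = i}) := by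
    intro ω hω
    exact mem_iUnion.2 ⟨C.X a ω, rfl, fun h => hω h.symm⟩
  rw [← ofReal_measureReal]
  refine ENNReal.ofReal_le_ofReal ?_
  calc P.real {ω | C.X a ω ≠ C.X b ω}
      ≤ P.real (⋃ i, ({ω | C.X a ω = i} \ {ω | C.X b ω = i})) := measureReal_mono h1
    _ ≤ ∑ i, P.real ({ω | C.X a ω = i} \ {ω | C.X b ω = i}) := measureReal_iUnion_fintype_le _
    _ ≤ ∑ i : Fin N, N * |K| * (b - a) := Finset.sum_le_sum fun i _ => key a b hab i
    _ = _ := by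
      rw [Real.coe_toNNReal _ (by positivity)]
      simp
      ring

/-- The expected number of jumps in bounded time is finite. -/
theorem lintegral_jumpMeasure_lt_top (t : ℝ≥0) :
    ∫⁻ ω, jumpMeasure (fun s => C.X s ω) (Ioc 0 t) ∂P < ∞ := by
  obtain ⟨K, hK⟩ := C.exists_measureReal_ne_le
  let D : ℕ → Ω → ℝ≥0∞ := fun n ω => ∑ k ∈ Finset.range (n + 1),
    if C.X (t * (k / (n + 1))) ω = C.X (t * ((k + 1 : ℕ) / (n + 1))) ω then (0 : ℝ≥0∞) else 1
  have hD : ∀ n, Measurable (D n) := fun n =>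
    Finset.measurable_sum _ fun k _ => C.measurable_ite_X_eq _ _
  -- The linear estimate on each of the `n + 1` grid steps of length `t / (n + 1)` gives a bound
  -- free of `n`, so Fatou's lemma applies.
  have hDint : ∀ n, ∫⁻ ω, D n ω ∂P ≤ ENNReal.ofReal (K * t) := by
    intro n
    rw [lintegral_finsetSum _ fun k _ => C.measurable_ite_X_eq _ _]
    calc _ ≤ ∑ k ∈ Finset.range (n + 1), ENNReal.ofReal (K * (t * (1 / (n + 1)))) := by
          refine Finset.sum_le_sum fun k _ => ?_
          have h1 : t * ((k : ℝ≥0) / (n + 1)) ≤ t * ((k + 1 : ℕ) / (n + 1)) := by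
            gcongr; simp
          have h2 : ∀ a b : ℝ≥0, ∫⁻ ω, (if C.X a ω = C.X b ω then (0 : ℝ≥0∞) else 1) ∂P =
              P {ω | C.X a ω ≠ C.X b ω} := by
            intro a b
            rw [show {ω | C.X a ω ≠ C.X b ω} = {ω | C.X a ω = C.X b ω}ᶜ from rfl,
              ← lintegral_indicator_one
              (measurableSet_eq_fun (C.measurable_X a) (C.measurable_X b)).compl]
            refine lintegral_congr fun ω => ?_
            by_cases h : C.X a ω = C.X b ω <;> simp [h]
          rw [h2]
          refine (hK _ _ h1).trans (le_of_eq ?_)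
          congr 2
          push_cast
          ring
      _ = ENNReal.ofReal (K * t) := by
          rw [Finset.sum_const, Finset.card_range, nsmul_eq_mul, ← ENNReal.ofReal_natCast,
            ← ENNReal.ofReal_mul (by positivity)]
          congr 1
          push_cast
          field_simp
  calc ∫⁻ ω, jumpMeasure (fun s => C.X s ω) (Ioc 0 t) ∂P
      = ∫⁻ ω, liminf (fun n => D n ω) atTop ∂P := by
        refine lintegral_congr fun ω => ?_
        refine (Tendsto.liminf_eq (tendsto_const_nhds.congr' ?_)).symm
        filter_upwards [(C.isStepPath ω).eventually_sum_eq_jumpMeasure t] with n hn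
        convert hn.symm
    _ ≤ liminf (fun n => ∫⁻ ω, D n ω ∂P) atTop := lintegral_liminf_le hD
    _ ≤ ENNReal.ofReal (K * t) :=
        liminf_le_of_frequently_le' (Frequently.of_forall hDint)
    _ < ∞ := ENNReal.ofReal_lt_top

end MarkovChain

/-! ### The Lévy system: predictable intensities of the jumps. -/

theorem ae_ae_of_ae_prod_swap {α β : Type*} [MeasurableSpace α] [MeasurableSpace β]
    {μ : Measure α} {ν : Measure β} [SFinite μ] [SFinite ν] {p : α → β → Prop}
    (h : ∀ᵐ q ∂μ.prod ν, p q.1 q.2) : ∀ᵐ y ∂ν, ∀ᵐ x ∂μ, p x y :=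
  Measure.ae_ae_of_ae_prod
    ((Measure.measurePreserving_swap (μ := ν) (ν := μ)).quasiMeasurePreserving.ae h)

theorem ae_prod_of_ae_ae_swap {α β : Type*} [MeasurableSpace α] [MeasurableSpace β]
    {μ : Measure α} {ν : Measure β} [SFinite μ] [SFinite ν] {p : α → β → Prop}
    (hp : MeasurableSet {q : α × β | p q.1 q.2}) (h : ∀ᵐ y ∂ν, ∀ᵐ x ∂μ, p x y) :
    ∀ᵐ q ∂μ.prod ν, p q.1 q.2 :=
  (Measure.ae_prod_iff_ae_ae hp).2 ((Measure.ae_ae_comm hp).2 h)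

theorem isPiSystem_predictable {Ω : Type*} {m : MeasurableSpace Ω} (𝓕 : Filtration ℝ≥0 m) :
    IsPiSystem ({s : Set (ℝ≥0 × Ω) | ∃ A, MeasurableSet[𝓕 ⊥] A ∧ s = {⊥} ×ˢ A} ∪
      {s | ∃ i A, MeasurableSet[𝓕 i] A ∧ s = Ioi i ×ˢ A}) := by
  have hd : ∀ i : ℝ≥0, ({⊥} : Set ℝ≥0) ∩ Ioi i = ∅ := fun i => by
    ext s; simp only [mem_inter_iff, mem_singleton_iff, mem_Ioi, mem_empty_iff_false, iff_false]
    rintro ⟨rfl, h⟩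
    exact not_lt_bot h
  rintro _ (⟨A, hA, rfl⟩ | ⟨i, A, hA, rfl⟩) _ (⟨B, hB, rfl⟩ | ⟨j, B, hB, rfl⟩) -
  · exact Or.inl ⟨A ∩ B, hA.inter hB, by rw [prod_inter_prod, inter_self]⟩
  · exact Or.inl ⟨∅, @MeasurableSet.empty _ (𝓕 ⊥), by rw [prod_inter_prod, hd]; simp⟩
  · exact Or.inl ⟨∅, @MeasurableSet.empty _ (𝓕 ⊥), by rw [prod_inter_prod, inter_comm (Ioi i), hd]; simp⟩
  · refine Or.inr ⟨i ⊔ j, A ∩ B, ?_, by rw [prod_inter_prod, Ioi_inter_Ioi]⟩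
    exact (𝓕.mono le_sup_left _ hA).inter (𝓕.mono le_sup_right _ hB)

namespace MarkovChain

variable {Ω : Type*} [m : MeasurableSpace Ω] {P : Measure Ω} {N : ℕ} (C : MarkovChain P N)

/-- The jump times up to `T`, as a random measure on `ℝ≥0 × Ω`. -/
noncomputable def jumpKernel (T : ℝ≥0) (ω : Ω) : Measure (ℝ≥0 × Ω) :=
  ((jumpMeasure fun s => C.X s ω).restrict (Ioc 0 T)).map fun s => (s, ω)

theorem jumpKernel_apply (T : ℝ≥0) (ω : Ω) {B : Set (ℝ≥0 × Ω)} (hB : MeasurableSet B) :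
    C.jumpKernel T ω B = jumpMeasure (fun s => C.X s ω) (Ioc 0 T ∩ {s | (s, ω) ∈ B}) := by
  rw [jumpKernel, Measure.map_apply measurable_prodMk_right hB,
    Measure.restrict_apply (measurable_prodMk_right hB), inter_comm]
  rfl

theorem measurable_restrict_jumpMeasure (T : ℝ≥0) :
    Measurable fun ω => (jumpMeasure fun s => C.X s ω).restrict (Ioc 0 T) := by
  have : ∀ ω, IsFiniteMeasure ((jumpMeasure fun s => C.X s ω).restrict (Ioc 0 T)) :=
    fun ω => (C.isStepPath ω).isFiniteMeasure_jumpMeasure 0 T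
  refine Measurable.measure_of_isPiSystem
    ((BorelSpace.measurable_eq (α := ℝ≥0)).trans (borel_eq_generateFrom_Iic ℝ≥0))
    isPiSystem_Iic ?_ ?_
  · rintro _ ⟨t, rfl⟩
    have : ∀ ω, ((jumpMeasure fun s => C.X s ω).restrict (Ioc 0 T)) (Iic t) =
        jumpMeasure (fun s => C.X s ω) (Ioc 0 (min t T)) := fun ω => by
      rw [Measure.restrict_apply measurableSet_Iic]
      congr 1
      ext s
      simp only [mem_inter_iff, mem_Iic, mem_Ioc, le_min_iff]
      tauto
    simp_rw [this]
    exact C.measurable_jumpMeasure_Ioc _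
  · simp_rw [Measure.restrict_apply_univ]
    exact C.measurable_jumpMeasure_Ioc _

theorem measurable_jumpKernel (T : ℝ≥0) : Measurable (C.jumpKernel T) := by
  have : ∀ ω, IsFiniteMeasure ((jumpMeasure fun s => C.X s ω).restrict (Ioc 0 T)) :=
    fun ω => (C.isStepPath ω).isFiniteMeasure_jumpMeasure 0 T
  have : ∀ ω, IsFiniteMeasure (C.jumpKernel T ω) := fun ω => by
    unfold jumpKernel; infer_instance
  refine Measurable.measure_of_isPiSystem generateFrom_prod.symm isPiSystem_prod ?_ ?_
  · rintro _ ⟨s, hs, F, hF, rfl⟩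
    replace hs : MeasurableSet s := hs
    replace hF : MeasurableSet F := hF
    have h1 : ∀ ω, C.jumpKernel T ω (s ×ˢ F) = F.indicator
        (fun ω => ((jumpMeasure fun s => C.X s ω).restrict (Ioc 0 T)) s) ω := by
      intro ω
      rw [C.jumpKernel_apply T ω (hs.prod hF)]
      by_cases h : ω ∈ F
      · simp [h, Measure.restrict_apply hs, inter_comm]
      · simp [h]
    simp_rw [h1]
    exact ((Measure.measurable_coe hs).comp (C.measurable_restrict_jumpMeasure T)).indicator hF
  · simp_rw [C.jumpKernel_apply T _ MeasurableSet.univ]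
    simpa using C.measurable_jumpMeasure_Ioc T

/-- The expected number of jumps up to `T` in a set of pairs `(t, ω)`. -/
noncomputable def meanJumps (T : ℝ≥0) : Measure (ℝ≥0 × Ω) := P.bind (C.jumpKernel T)

theorem meanJumps_apply (T : ℝ≥0) {B : Set (ℝ≥0 × Ω)} (hB : MeasurableSet B) :
    C.meanJumps T B =
      ∫⁻ ω, jumpMeasure (fun s => C.X s ω) (Ioc 0 T ∩ {s | (s, ω) ∈ B}) ∂P := by
  rw [meanJumps, Measure.bind_apply hB (C.measurable_jumpKernel T).aemeasurable]
  simp_rw [C.jumpKernel_apply T _ hB]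

theorem meanJumps_eq_zero_iff (T : ℝ≥0) {B : Set (ℝ≥0 × Ω)} (hB : MeasurableSet B) :
    C.meanJumps T B = 0 ↔
      ∀ᵐ ω ∂P, ∀ s ∈ Ioc 0 T, (s, ω) ∈ B → C.Xleft s ω = C.X s ω := by
  rw [C.meanJumps_apply T hB, lintegral_eq_zero_iff]
  · refine eventually_congr (Eventually.of_forall fun ω => ?_)
    rw [Pi.zero_apply, (C.isStepPath ω).jumpMeasure_eq_zero_iff]
    simp only [jumps, mem_inter_iff, mem_ofPred_eq, not_not, and_imp]
    rfl
  · simp_rw [← C.jumpKernel_apply T _ hB]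
    exact (Measure.measurable_coe hB).comp (C.measurable_jumpKernel T)

instance isFiniteMeasure_restrict_Ioc (a T : ℝ≥0) :
    IsFiniteMeasure (timeMeasure.restrict (Ioc a T)) where
  measure_univ_lt_top := by
    rw [Measure.restrict_apply_univ, timeMeasure_Ioc]
    exact ENNReal.ofReal_lt_top

theorem integrable_A_Xleft (k : Fin N) (μ : Measure (ℝ≥0 × Ω)) [IsFiniteMeasure μ] :
    Integrable (fun q => C.A q.1 k (C.Xleft q.1 q.2)) μ := by
  obtain ⟨K, hK⟩ := C.isRateMatrix.bounded
  exact Integrable.of_bound (C := K) (C.measurable_A_Xleft k).aestronglyMeasurable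
    (ae_of_all _ fun q => hK q.1 k _)

theorem measurableSet_uncurry_X (k : Fin N) :
    MeasurableSet {q : ℝ≥0 × Ω | C.X q.1 q.2 = k} :=
  C.measurable_uncurry_X (measurableSet_singleton k)

variable [IsProbabilityMeasure P]

instance isFiniteMeasure_meanJumps (T : ℝ≥0) : IsFiniteMeasure (C.meanJumps T) where
  measure_univ_lt_top := by
    rw [C.meanJumps_apply T MeasurableSet.univ]
    simpa using C.lintegral_jumpMeasure_lt_top T

/-- The two parts of the rate stand on opposite sides so that every term is nonnegative and can be
read as a measure. `X_{t-}` may replace `X_t` since they differ at countably many times; it makes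
the integrand predictable. -/
theorem forward_eq_lintegral {a b : ℝ≥0} (hab : a ≤ b) {F : Set Ω} (hF : MeasurableSet[C.ℱ a] F)
    (k : Fin N) :
    P (F ∩ {ω | C.X b ω = k}) + ∫⁻ q in Ioc a b ×ˢ F,
      ENNReal.ofReal (-C.A q.1 k (C.Xleft q.1 q.2)) ∂timeMeasure.prod P =
    P (F ∩ {ω | C.X a ω = k}) + ∫⁻ q in Ioc a b ×ˢ F,
      ENNReal.ofReal (C.A q.1 k (C.Xleft q.1 q.2)) ∂timeMeasure.prod P := by
  have hF' := C.ℱ.le a _ hF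
  have hfin : IsFiniteMeasure ((timeMeasure.prod P).restrict (Ioc a b ×ˢ F)) := by
    rw [← Measure.prod_restrict]; infer_instance
  have hint := C.integrable_A_Xleft k ((timeMeasure.prod P).restrict (Ioc a b ×ˢ F))
  have h1 := C.measureReal_inter_X hab hF k
  have h2 : ∫ u in Ioc a b, (∑ j, C.A u k j * P.real (F ∩ {ω | C.X u ω = j})) ∂timeMeasure =
      ∫ q in Ioc a b ×ˢ F, C.A q.1 k (C.Xleft q.1 q.2) ∂timeMeasure.prod P := by
    rw [setIntegral_prod _ hint]
    have hae : ∀ᵐ u ∂timeMeasure, ∀ᵐ ω ∂P, C.Xleft u ω = C.X u ω :=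
      (Measure.ae_ae_comm (p := fun u ω => C.Xleft u ω = C.X u ω)
        (measurableSet_eq_fun C.measurable_Xleft C.measurable_uncurry_X)).2 (ae_of_all _ fun ω => (C.isStepPath ω).ae_leftLim_eq)
    refine setIntegral_congr_ae measurableSet_Ioc (hae.mono fun u hu _ => ?_)
    rw [← C.setIntegral_comp_X F u (fun j => C.A u k j)]
    exact setIntegral_congr_ae hF' (hu.mono fun ω hω _ => by rw [hω])
  rw [h2, integral_eq_lintegral_pos_part_sub_lintegral_neg_part hint] at h1
  have f1 := hint.lintegral_lt_top.ne
  have f2 := hint.neg.lintegral_lt_top.ne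
  simp only [Pi.neg_apply] at f2
  rw [← ENNReal.toReal_eq_toReal_iff' (ENNReal.add_ne_top.2 ⟨measure_ne_top _ _, f2⟩)
    (ENNReal.add_ne_top.2 ⟨measure_ne_top _ _, f1⟩), ENNReal.toReal_add (measure_ne_top _ _) f2,
    ENNReal.toReal_add (measure_ne_top _ _) f1]
  simp only [measureReal_def] at h1
  linarith

/-- Integrate `jumpMeasure_enter_leave` over `F` and combine it with the forward equation: the
boundary terms `P(F, X_a = k)` and `P(F, X_T = k)` cancel. -/
theorem jumps_balance_Ioi {a T : ℝ≥0} {F : Set Ω} (hF : MeasurableSet[C.ℱ a] F) (k : Fin N) :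
    C.meanJumps T ((Ioi a ×ˢ F) ∩ {q | C.X q.1 q.2 = k}) + ∫⁻ q in Ioi a ×ˢ F,
      ENNReal.ofReal (-C.A q.1 k (C.Xleft q.1 q.2)) ∂(timeMeasure.restrict (Ioc 0 T)).prod P =
    C.meanJumps T ((Ioi a ×ˢ F) ∩ {q | C.Xleft q.1 q.2 = k}) + ∫⁻ q in Ioi a ×ˢ F,
      ENNReal.ofReal (C.A q.1 k (C.Xleft q.1 q.2)) ∂(timeMeasure.restrict (Ioc 0 T)).prod P := by
  have hF' := C.ℱ.le a _ hF
  have hI : Ioc 0 T ∩ Ioi a = Ioc a T := by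
    ext s
    simp only [mem_inter_iff, mem_Ioc, mem_Ioi]
    exact ⟨fun h => ⟨h.2, h.1.2⟩, fun h => ⟨⟨zero_le.trans_lt h.1, h.2⟩, h.1⟩⟩
  have hμ : ((timeMeasure.restrict (Ioc 0 T)).prod P).restrict (Ioi a ×ˢ F) =
      (timeMeasure.prod P).restrict (Ioc a T ×ˢ F) := by
    rw [← Measure.prod_restrict, ← Measure.prod_restrict,
      Measure.restrict_restrict measurableSet_Ioi, inter_comm, hI]
  have hν : ∀ x : ℝ≥0 → Ω → Fin N, (Measurable fun q : ℝ≥0 × Ω => x q.1 q.2) →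
      C.meanJumps T ((Ioi a ×ˢ F) ∩ {q | x q.1 q.2 = k}) =
        ∫⁻ ω in F, jumpMeasure (fun s => C.X s ω) (Ioc a T ∩ {s | x s ω = k}) ∂P := by
    intro x hx
    have hxk : MeasurableSet {q : ℝ≥0 × Ω | x q.1 q.2 = k} := hx (measurableSet_singleton k)
    rw [C.meanJumps_apply T ((measurableSet_Ioi.prod hF').inter hxk), ← lintegral_indicator hF']
    refine lintegral_congr fun ω => ?_
    by_cases h : ω ∈ F
    · rw [indicator_of_mem h, ← hI, inter_assoc]
      congr 2
      ext s; simp [h]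
    · simp [h]
  rw [hμ]
  rcases lt_or_ge T a with haT | haT
  · rw [hν C.X C.measurable_uncurry_X, hν C.Xleft C.measurable_Xleft, Ioc_eq_empty_of_le haT.le]
    simp
  have h1 := C.forward_eq_lintegral haT hF k
  have h2 : C.meanJumps T ((Ioi a ×ˢ F) ∩ {q | C.X q.1 q.2 = k}) + P (F ∩ {ω | C.X a ω = k}) =
      C.meanJumps T ((Ioi a ×ˢ F) ∩ {q | C.Xleft q.1 q.2 = k}) + P (F ∩ {ω | C.X T ω = k}) := by
    classical
    have hp : ∀ t, P (F ∩ {ω | C.X t ω = k}) = ∫⁻ ω in F, (if C.X t ω = k then 1 else 0) ∂P := by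
      intro t
      rw [inter_comm, ← Measure.restrict_apply (C.measurableSet_X t k),
        ← lintegral_indicator_one (C.measurableSet_X t k)]
      refine lintegral_congr fun ω => ?_
      simp [indicator_apply]
    have hm : ∀ t, Measurable fun ω => if C.X t ω = k then (1 : ℝ≥0∞) else 0 := fun t =>
      Measurable.ite (C.measurableSet_X t k) measurable_const measurable_const
    rw [hν C.X C.measurable_uncurry_X, hν C.Xleft C.measurable_Xleft, hp, hp,
      ← lintegral_add_right _ (hm a), ← lintegral_add_right _ (hm T)]
    refine lintegral_congr fun ω => ?_
    convert (C.isStepPath ω).jumpMeasure_enter_leave haT k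
    rfl
  have key : ∀ n p l l' n' p' : ℝ≥0∞, p ≠ ∞ → p' ≠ ∞ → n + p = n' + p' → p' + l = p + l' →
      n + l = n' + l' := by
    intro n p l l' n' p' hp hp' h1 h2
    refine (ENNReal.add_left_inj (ENNReal.add_ne_top.2 ⟨hp, hp'⟩)).1 ?_
    calc n + l + (p + p') = (n + p) + (p' + l) := by ring
      _ = n' + l' + (p + p') := by rw [h1, h2]; ring
  exact key _ _ _ _ _ _ (measure_ne_top _ _) (measure_ne_top _ _) h2 h1

/-- Both sides are finite measures in `B` that agree on the π-system of generating rectangles, hence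
on the predictable σ-algebra. Rectangles over time `0` are null on both sides. -/
theorem jumps_balance (T : ℝ≥0) (k : Fin N) {B : Set (ℝ≥0 × Ω)}
    (hB : MeasurableSet[C.ℱ.predictable] B) :
    C.meanJumps T (B ∩ {q | C.X q.1 q.2 = k}) + ∫⁻ q in B,
      ENNReal.ofReal (-C.A q.1 k (C.Xleft q.1 q.2)) ∂(timeMeasure.restrict (Ioc 0 T)).prod P =
    C.meanJumps T (B ∩ {q | C.Xleft q.1 q.2 = k}) + ∫⁻ q in B,
      ENNReal.ofReal (C.A q.1 k (C.Xleft q.1 q.2)) ∂(timeMeasure.restrict (Ioc 0 T)).prod P := by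
  have hle := predictable_le C.ℱ
  let μT := (timeMeasure.restrict (Ioc 0 T)).prod P
  have hint := C.integrable_A_Xleft k μT
  let μ₁ : Measure (ℝ≥0 × Ω) := (C.meanJumps T).restrict {q | C.X q.1 q.2 = k} +
    μT.withDensity fun q => ENNReal.ofReal (-C.A q.1 k (C.Xleft q.1 q.2))
  let μ₂ : Measure (ℝ≥0 × Ω) := (C.meanJumps T).restrict {q | C.Xleft q.1 q.2 = k} +
    μT.withDensity fun q => ENNReal.ofReal (C.A q.1 k (C.Xleft q.1 q.2))
  have e1 : ∀ S, MeasurableSet[C.ℱ.predictable] S → μ₁ S =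
      C.meanJumps T (S ∩ {q | C.X q.1 q.2 = k}) +
        ∫⁻ q in S, ENNReal.ofReal (-C.A q.1 k (C.Xleft q.1 q.2)) ∂μT := fun S hS => by
    rw [Measure.add_apply, Measure.restrict_apply (hle _ hS), withDensity_apply _ (hle _ hS)]
  have e2 : ∀ S, MeasurableSet[C.ℱ.predictable] S → μ₂ S =
      C.meanJumps T (S ∩ {q | C.Xleft q.1 q.2 = k}) +
        ∫⁻ q in S, ENNReal.ofReal (C.A q.1 k (C.Xleft q.1 q.2)) ∂μT := fun S hS => by
    rw [Measure.add_apply, Measure.restrict_apply (hle _ hS), withDensity_apply _ (hle _ hS)]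
  have : IsFiniteMeasure (μT.withDensity fun q => ENNReal.ofReal (-C.A q.1 k (C.Xleft q.1 q.2))) :=
    isFiniteMeasure_withDensity (by simpa using hint.neg.lintegral_lt_top.ne)
  have hz : ∀ A, MeasurableSet[C.ℱ ⊥] A → ∀ S : Set (ℝ≥0 × Ω),
      C.meanJumps T (({⊥} ×ˢ A) ∩ S) = 0 := by
    intro A hA S
    refine measure_mono_null (inter_subset_left.trans (prod_mono_right (subset_univ A))) ?_
    rw [C.meanJumps_eq_zero_iff T ((measurableSet_singleton _).prod MeasurableSet.univ)]
    refine ae_of_all _ fun ω s hs h => ?_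
    have h0 : s = 0 := h.1
    exact absurd hs.1 (by simp [h0])
  have hz' : ∀ A : Set Ω, μT.restrict ({⊥} ×ˢ A) = 0 := by
    intro A
    rw [Measure.restrict_eq_zero, Measure.prod_prod, Measure.restrict_apply
      (measurableSet_singleton _), measure_mono_null inter_subset_left (measure_singleton _),
      zero_mul]
  have hgen : ∀ S ∈ ({s : Set (ℝ≥0 × Ω) | ∃ A, MeasurableSet[C.ℱ ⊥] A ∧ s = {⊥} ×ˢ A} ∪
      {s | ∃ i A, MeasurableSet[C.ℱ i] A ∧ s = Ioi i ×ˢ A}), μ₁ S = μ₂ S := by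
    rintro _ (⟨A, hA, rfl⟩ | ⟨i, A, hA, rfl⟩)
    · have := measurableSet_predictable_singleton_bot_prod hA
      rw [e1 _ this, e2 _ this, hz A hA, hz A hA, hz' A]
      simp
    · have := measurableSet_predictable_Ioi_prod hA
      rw [e1 _ this, e2 _ this]
      exact C.jumps_balance_Ioi hA k
  have heq : μ₁.trim hle = μ₂.trim hle := by
    refine @ext_of_generate_finite _ C.ℱ.predictable _ _ _ rfl (isPiSystem_predictable C.ℱ) _
      (fun S hS => ?_) ?_
    · have hS' : MeasurableSet[C.ℱ.predictable] S := MeasurableSpace.measurableSet_generateFrom hS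
      rw [trim_measurableSet_eq hle hS', trim_measurableSet_eq hle hS', hgen S hS]
    · have hu : (univ : Set (ℝ≥0 × Ω)) = ({⊥} ×ˢ univ) ∪ (Ioi ⊥ ×ˢ univ) := by
        ext ⟨s, ω⟩
        simpa using eq_zero_or_pos s
      have hd : Disjoint (({⊥} : Set ℝ≥0) ×ˢ (univ : Set Ω)) (Ioi ⊥ ×ˢ univ) := by
        rw [Set.disjoint_prod]
        left
        simp
      have hm := hle _ (measurableSet_predictable_Ioi_prod (𝓕 := C.ℱ) (i := ⊥) MeasurableSet.univ)
      rw [trim_measurableSet_eq hle MeasurableSet.univ, trim_measurableSet_eq hle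
        MeasurableSet.univ, hu, measure_union hd hm, measure_union hd hm,
        hgen _ (Or.inl ⟨univ, MeasurableSet.univ, rfl⟩),
        hgen _ (Or.inr ⟨⊥, univ, MeasurableSet.univ, rfl⟩)]
  have := congrArg (fun μ => μ B) heq
  simp only [trim_measurableSet_eq hle hB] at this
  rw [e1 B hB, e2 B hB] at this
  exact this

/-- The Lévy system of the chain: the predictable intensity of the jumps from `j` to `k` is the
rate `A_t k j` on `X_{t-} = j`. -/
theorem meanJumps_eq_lintegral (T : ℝ≥0) {j k : Fin N} (hjk : j ≠ k) {B : Set (ℝ≥0 × Ω)}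
    (hB : MeasurableSet[C.ℱ.predictable] B) :
    C.meanJumps T (B ∩ {q | C.Xleft q.1 q.2 = j} ∩ {q | C.X q.1 q.2 = k}) =
      ∫⁻ q in B ∩ {q | C.Xleft q.1 q.2 = j}, ENNReal.ofReal (C.A q.1 k j)
        ∂(timeMeasure.restrict (Ioc 0 T)).prod P := by
  have hB' : MeasurableSet[C.ℱ.predictable] (B ∩ {q | C.Xleft q.1 q.2 = j}) :=
    hB.inter (C.measurable_Xleft_predictable (measurableSet_singleton j))
  -- On `X_{t-} = j` with `j ≠ k` no jump leaves `k` and the rate into `k` is nonnegative, so only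
  -- entries from `j` and their rate survive in the balance.
  have h := C.jumps_balance T k hB'
  have hm := predictable_le C.ℱ _ hB'
  have h1 : ∫⁻ q in B ∩ {q | C.Xleft q.1 q.2 = j}, ENNReal.ofReal
      (-C.A q.1 k (C.Xleft q.1 q.2)) ∂(timeMeasure.restrict (Ioc 0 T)).prod P = 0 := by
    rw [setLIntegral_congr_fun (g := fun _ => 0) hm, lintegral_zero]
    intro q hq
    have hq' : C.Xleft q.1 q.2 = j := hq.2
    simpa [hq'] using C.isRateMatrix.nonneg q.1 k j hjk.symm
  have h2 : B ∩ {q | C.Xleft q.1 q.2 = j} ∩ {q | C.Xleft q.1 q.2 = k} = ∅ := by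
    ext q
    simp only [mem_inter_iff, mem_ofPred_eq, mem_empty_iff_false, iff_false]
    rintro ⟨⟨-, h1⟩, h2⟩
    exact hjk (h1.symm.trans h2)
  have h3 : ∫⁻ q in B ∩ {q | C.Xleft q.1 q.2 = j}, ENNReal.ofReal
      (C.A q.1 k (C.Xleft q.1 q.2)) ∂(timeMeasure.restrict (Ioc 0 T)).prod P =
      ∫⁻ q in B ∩ {q | C.Xleft q.1 q.2 = j}, ENNReal.ofReal (C.A q.1 k j)
        ∂(timeMeasure.restrict (Ioc 0 T)).prod P := by
    refine setLIntegral_congr_fun hm fun q hq => ?_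
    have hq' : C.Xleft q.1 q.2 = j := hq.2
    simp only [hq']
  rwa [h1, h2, h3, measure_empty, add_zero, zero_add] at h

/-- No jump from `j` to `k` occurs in the predictable set `B` if and only if the rate of these jumps
vanishes on `B`. -/
theorem ae_no_jump_iff {j k : Fin N} (hjk : j ≠ k) {B : Set (ℝ≥0 × Ω)}
    (hB : MeasurableSet[C.ℱ.predictable] B) :
    (∀ᵐ ω ∂P, ∀ s, C.Xleft s ω = j → C.X s ω = k → (s, ω) ∉ B) ↔
      ∀ᵐ q ∂timeMeasure.prod P, C.Xleft q.1 q.2 = j → q ∈ B → C.A q.1 k j = 0 := by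
  have hB' : MeasurableSet[C.ℱ.predictable] (B ∩ {q | C.Xleft q.1 q.2 = j}) :=
    hB.inter (C.measurable_Xleft_predictable (measurableSet_singleton j))
  have hm : MeasurableSet (B ∩ {q | C.Xleft q.1 q.2 = j}) := predictable_le C.ℱ _ hB'
  have hA : Measurable fun q : ℝ≥0 × Ω => ENNReal.ofReal (C.A q.1 k j) :=
    ((C.isRateMatrix.measurable k j).comp measurable_fst).ennreal_ofReal
  have key : ∀ T : ℝ≥0, (∀ᵐ ω ∂P, ∀ s ∈ Ioc 0 T, C.Xleft s ω = j → C.X s ω = k → (s, ω) ∉ B) ↔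
      ∀ᵐ q ∂timeMeasure.prod P, q.1 ∈ Ioc 0 T → C.Xleft q.1 q.2 = j → q ∈ B → C.A q.1 k j = 0 := by
    intro T
    have h := C.meanJumps_eq_lintegral T hjk hB
    have hiff : C.meanJumps T (B ∩ {q | C.Xleft q.1 q.2 = j} ∩ {q | C.X q.1 q.2 = k}) = 0 ↔
        ∫⁻ q in B ∩ {q | C.Xleft q.1 q.2 = j}, ENNReal.ofReal (C.A q.1 k j)
        ∂(timeMeasure.restrict (Ioc 0 T)).prod P = 0 := by rw [h]
    rw [C.meanJumps_eq_zero_iff T (hm.inter (C.measurableSet_uncurry_X k)),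
      lintegral_eq_zero_iff hA] at hiff
    have hr : (timeMeasure.restrict (Ioc 0 T)).prod P =
        (timeMeasure.prod P).restrict (Ioc 0 T ×ˢ univ) := by
      rw [← Measure.prod_restrict, Measure.restrict_univ]
    refine (eventually_congr (Eventually.of_forall fun ω => ?_)).trans (hiff.trans ?_)
    · refine forall₂_congr fun s _ => ⟨?_, ?_⟩
      · rintro h ⟨⟨h1, h2⟩, h3⟩
        exact absurd h1 (h h2 h3)
      · intro h h1 h2 h3
        have h4 := h ⟨⟨h3, h1⟩, h2⟩
        exact hjk (h1.symm.trans (h4.trans h2))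
    · rw [hr, Filter.EventuallyEq, ae_restrict_iff' hm, ae_restrict_iff'
        (measurableSet_Ioc.prod MeasurableSet.univ)]
      refine eventually_congr (Eventually.of_forall fun q => ?_)
      have h0 : ENNReal.ofReal (C.A q.1 k j) = 0 ↔ C.A q.1 k j = 0 := by
        rw [ENNReal.ofReal_eq_zero]
        exact ⟨fun h => le_antisymm h (C.isRateMatrix.nonneg q.1 k j hjk.symm), fun h => h.le⟩
      rw [Pi.zero_apply, h0]
      simp only [mem_prod, mem_univ, and_true, mem_inter_iff, mem_ofPred_eq]
      tauto
  constructor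
  · intro h
    have : ∀ᵐ q ∂timeMeasure.prod P, ∀ n : ℕ, q.1 ∈ Ioc (0 : ℝ≥0) n →
        C.Xleft q.1 q.2 = j → q ∈ B → C.A q.1 k j = 0 :=
      ae_all_iff.2 fun n => (key n).1 (h.mono fun ω hω s _ => hω s)
    have h0 : ∀ᵐ q ∂timeMeasure.prod P, q.1 ≠ 0 := by
      refine Measure.quasiMeasurePreserving_fst.ae (p := fun s => s ≠ 0) ?_
      exact compl_mem_ae_iff.2 (measure_singleton 0)
    filter_upwards [this, h0] with q hq hq0
    obtain ⟨n, hn⟩ := exists_nat_ge q.1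
    exact hq n ⟨pos_iff_ne_zero.2 hq0, hn⟩
  · intro h
    have : ∀ᵐ ω ∂P, ∀ n : ℕ, ∀ s ∈ Ioc (0 : ℝ≥0) n,
        C.Xleft s ω = j → C.X s ω = k → (s, ω) ∉ B :=
      ae_all_iff.2 fun n => (key n).2 (h.mono fun q hq _ => hq)
    filter_upwards [this] with ω hω s h1 h2
    obtain ⟨n, hn⟩ := exists_nat_ge s
    refine hω n s ⟨pos_iff_ne_zero.2 ?_, hn⟩ h1 h2
    rintro rfl
    rw [Xleft, leftLim_zero] at h1
    exact hjk (h1.symm.trans h2)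

end MarkovChain

/-! ### The stochastic seminorm and the jumps of the chain. -/

theorem dotProduct_e {N : ℕ} (z : Fin N → ℝ) (i : Fin N) : z ⬝ᵥ e i = z i := by
  simp [e]

theorem mulVec_e {N : ℕ} (A : Matrix (Fin N) (Fin N) ℝ) (i j : Fin N) : (A *ᵥ e j) i = A i j := by
  simp [e]

/-- The vanishing column sum lets one add a multiple of `z_j^2` and complete the squares. The
seminorm thus sees only increments of `z` along transitions out of `j`. -/
theorem dotProduct_Psi_mulVec {N : ℕ} (A : Matrix (Fin N) (Fin N) ℝ) (j : Fin N)
    (hA : ∑ i, A i j = 0) (z : Fin N → ℝ) :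
    z ⬝ᵥ (MarkovChain.Psi A (e j) *ᵥ z) = ∑ i, A i j * (z i - z j) ^ 2 := by
  have h1 : ∀ i, (MarkovChain.Psi A (e j) *ᵥ z) i =
      A i j * z i - A i j * z j - (if i = j then ∑ l, A l j * z l else 0) := by
    intro i
    have h2 : Matrix.diagonal (e j) *ᵥ z = fun l => if l = j then z j else 0 := by
      ext l
      rw [Matrix.mulVec_diagonal, e, Pi.single_apply]
      split_ifs with h <;> simp [h]
    have h3 : (A *ᵥ (Matrix.diagonal (e j) *ᵥ z)) i = A i j * z j := by
      rw [h2, Matrix.mulVec, dotProduct]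
      simp
    have h4 : (Matrix.diagonal (e j) *ᵥ (Aᵀ *ᵥ z)) i = if i = j then ∑ l, A l j * z l else 0 := by
      rw [Matrix.mulVec_diagonal, e, Pi.single_apply]
      split_ifs with h
      · subst h; simp [Matrix.mulVec, dotProduct]
      · simp
    rw [MarkovChain.Psi, Matrix.sub_mulVec, Matrix.sub_mulVec, ← Matrix.mulVec_mulVec,
      ← Matrix.mulVec_mulVec, Pi.sub_apply, Pi.sub_apply, h3, h4, Matrix.mulVec_diagonal, mulVec_e]
  simp only [dotProduct, h1]
  simp only [mul_sub, Finset.sum_sub_distrib, mul_ite, mul_zero, Finset.sum_ite_eq',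
    Finset.mem_univ, if_true]
  have h5 : ∑ i, A i j * (z i - z j) ^ 2 = ∑ i, z i * (A i j * z i) -
      ∑ i, z i * (A i j * z j) - z j * ∑ i, A i j * z i + (∑ i, A i j) * z j ^ 2 := by
    rw [Finset.mul_sum, Finset.sum_mul, ← Finset.sum_sub_distrib, ← Finset.sum_sub_distrib,
      ← Finset.sum_add_distrib]
    exact Finset.sum_congr rfl fun i _ => by ring
  rw [h5, hA]
  ring

namespace MarkovChain

variable {Ω : Type*} [m : MeasurableSpace Ω] {P : Measure Ω} {N : ℕ} (C : MarkovChain P N)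

theorem vecLeft_eq (t : ℝ≥0) (ω : Ω) : C.vecLeft t ω = e (C.Xleft t ω) := rfl

theorem dotProduct_jump (z : Fin N → ℝ) (t : ℝ≥0) (ω : Ω) :
    z ⬝ᵥ (C.vec t ω - C.vecLeft t ω) = z (C.X t ω) - z (C.Xleft t ω) := by
  rw [dotProduct_sub, vec, vecLeft_eq, dotProduct_e, dotProduct_e]

theorem seminormM_eq_zero_iff (t : ℝ≥0) (ω : Ω) (z : Fin N → ℝ) :
    C.seminormM t ω z = 0 ↔ ∀ k, C.Xleft t ω ≠ k → z k ≠ z (C.Xleft t ω) →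
      C.A t k (C.Xleft t ω) = 0 := by
  have hnn : ∀ k, 0 ≤ C.A t k (C.Xleft t ω) * (z k - z (C.Xleft t ω)) ^ 2 := by
    intro k
    rcases eq_or_ne k (C.Xleft t ω) with h | h
    · simp [h]
    · exact mul_nonneg (C.isRateMatrix.nonneg t _ _ h) (sq_nonneg _)
  rw [seminormM, vecLeft_eq, dotProduct_Psi_mulVec _ _ (C.isRateMatrix.sum_eq_zero t _),
    Real.sqrt_eq_zero (Finset.sum_nonneg fun k _ => hnn k),
    Finset.sum_eq_zero_iff_of_nonneg fun k _ => hnn k]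
  refine forall_congr' fun k => ?_
  simp only [Finset.mem_univ, true_imp_iff, mul_eq_zero, pow_eq_zero_iff, ne_eq,
    OfNat.ofNat_ne_zero, not_false_eq_true, sub_eq_zero]
  constructor
  · rintro (h | h) _ h2
    · exact h
    · exact absurd h h2
  · intro h
    by_cases h1 : C.Xleft t ω = k
    · right; rw [h1]
    · by_cases h2 : z k = z (C.Xleft t ω)
      · exact Or.inr h2
      · exact Or.inl (h h1 h2)

/-- Wherever the rate is nonzero, `z - z'` takes its value at the current state; that constant is
annihilated by the column sum. -/
theorem dotProduct_rate_eq_of_seminormM_eq_zero {t : ℝ≥0} {ω : Ω} {z z' : Fin N → ℝ}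
    (h : C.seminormM t ω (z - z') = 0) :
    z ⬝ᵥ (C.A t *ᵥ C.vecLeft t ω) = z' ⬝ᵥ (C.A t *ᵥ C.vecLeft t ω) := by
  rw [seminormM_eq_zero_iff] at h
  rw [← sub_eq_zero, ← sub_dotProduct, vecLeft_eq]
  have h1 : ∀ k, (z - z') k * C.A t k (C.Xleft t ω) =
      (z - z') (C.Xleft t ω) * C.A t k (C.Xleft t ω) := by
    intro k
    by_cases h1 : C.Xleft t ω = k
    · rw [h1]
    · by_cases h2 : (z - z') k = (z - z') (C.Xleft t ω)
      · rw [h2]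
      · rw [h k h1 h2, mul_zero, mul_zero]
  rw [dotProduct]
  simp_rw [mulVec_e, h1]
  rw [← Finset.mul_sum, C.isRateMatrix.sum_eq_zero, mul_zero]

theorem EquivM.ae_dotProduct_rate_eq [SFinite P] {Z Z' : ℝ≥0 → Ω → Fin N → ℝ}
    (h : C.EquivM Z Z') : ∀ᵐ ω ∂P, ∀ᵐ t ∂timeMeasure,
      Z t ω ⬝ᵥ (C.A t *ᵥ C.vecLeft t ω) = Z' t ω ⬝ᵥ (C.A t *ᵥ C.vecLeft t ω) := by
  have h' : ∀ᵐ q ∂timeMeasure.prod P, C.seminormM q.1 q.2 (Z q.1 q.2 - Z' q.1 q.2) = 0 := h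
  exact (ae_ae_of_ae_prod_swap (p := fun t ω => C.seminormM t ω (Z t ω - Z' t ω) = 0) h').mono
    fun ω hω => hω.mono fun t ht => C.dotProduct_rate_eq_of_seminormM_eq_zero ht

variable [IsProbabilityMeasure P]

/-- Predictable integrands are equivalent if and only if they have the same jump integrals. -/
theorem equivM_iff {Z Z' : ℝ≥0 → Ω → Fin N → ℝ} (hZ : IsStronglyPredictable C.ℱ Z)
    (hZ' : IsStronglyPredictable C.ℱ Z') : C.EquivM Z Z' ↔
      ∀ᵐ ω ∂P, ∀ s, Z s ω ⬝ᵥ (C.vec s ω - C.vecLeft s ω) =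
        Z' s ω ⬝ᵥ (C.vec s ω - C.vecLeft s ω) := by
  let W : ℝ≥0 → Ω → Fin N → ℝ := fun t ω => Z t ω - Z' t ω
  have hW : ∀ k, Measurable[C.ℱ.predictable] fun q : ℝ≥0 × Ω => W q.1 q.2 k := fun k =>
    ((measurable_pi_apply k).comp hZ.measurable).sub ((measurable_pi_apply k).comp hZ'.measurable)
  -- The predictable set where `Z - Z'` tells `j` from `k`. Both sides of the equivalence say, pair
  -- by pair, that these sets are missed: by the rates, or by the jumps.
  let B : Fin N → Fin N → Set (ℝ≥0 × Ω) := fun j k => {q | W q.1 q.2 k ≠ W q.1 q.2 j}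
  have hB : ∀ j k, MeasurableSet[C.ℱ.predictable] (B j k) := fun j k =>
    (@measurableSet_eq_fun _ _ C.ℱ.predictable _ _ _ _ (hW k) (hW j)).compl
  have h1 : C.EquivM Z Z' ↔ ∀ j k, j ≠ k →
      ∀ᵐ q ∂timeMeasure.prod P, C.Xleft q.1 q.2 = j → q ∈ B j k → C.A q.1 k j = 0 := by
    simp_rw [← eventually_all]
    refine eventually_congr (Eventually.of_forall fun q => ?_)
    rw [seminormM_eq_zero_iff]
    constructor
    · rintro h j k hjk rfl hq
      exact h k hjk hq
    · intro h k hk hne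
      exact h _ k hk rfl hne
  have h2 : (∀ᵐ ω ∂P, ∀ s, Z s ω ⬝ᵥ (C.vec s ω - C.vecLeft s ω) =
      Z' s ω ⬝ᵥ (C.vec s ω - C.vecLeft s ω)) ↔ ∀ j k, j ≠ k →
      ∀ᵐ ω ∂P, ∀ s, C.Xleft s ω = j → C.X s ω = k → (s, ω) ∉ B j k := by
    simp_rw [← eventually_all]
    refine eventually_congr (Eventually.of_forall fun ω => ?_)
    have h3 : ∀ s, (Z s ω ⬝ᵥ (C.vec s ω - C.vecLeft s ω) =
        Z' s ω ⬝ᵥ (C.vec s ω - C.vecLeft s ω)) ↔ W s ω (C.X s ω) = W s ω (C.Xleft s ω) := by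
      intro s
      rw [← sub_eq_zero, ← sub_dotProduct, dotProduct_jump, sub_eq_zero]
    simp_rw [h3]
    constructor
    · rintro h j k - s rfl rfl hn
      exact hn (h s)
    · intro h s
      by_contra hne
      exact h _ _ (fun h => hne (by rw [h])) s rfl rfl hne
  rw [h1, h2]
  exact forall₃_congr fun j k hjk => (C.ae_no_jump_iff hjk (hB j k)).symm

/-- The predictable set `{r} × Ω` is `dt × dP`-null, so by the Lévy system no jump falls in it. -/
theorem ae_notMem_jumps (r : ℝ≥0) : ∀ᵐ ω ∂P, r ∉ jumps fun s => C.X s ω := by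
  have hB : MeasurableSet[C.ℱ.predictable] ((Prod.fst : ℝ≥0 × Ω → ℝ≥0) ⁻¹' {r}) :=
    measurable_fst_predictable C.ℱ (measurableSet_singleton r)
  have h0 : ∀ᵐ q ∂timeMeasure.prod P, q.1 ≠ r := by
    refine Measure.quasiMeasurePreserving_fst.ae (p := fun s => s ≠ r) ?_
    exact compl_mem_ae_iff.2 (measure_singleton r)
  have h1 : ∀ j k, j ≠ k → ∀ᵐ ω ∂P, ∀ s, C.Xleft s ω = j → C.X s ω = k → (s, ω) ∉
      ((Prod.fst : ℝ≥0 × Ω → ℝ≥0) ⁻¹' {r}) := fun j k hjk =>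
    (C.ae_no_jump_iff hjk hB).2 (h0.mono fun q hq _ h => absurd h hq)
  simp_rw [← eventually_all] at h1
  filter_upwards [h1] with ω hω hr
  exact hω (C.Xleft r ω) (C.X r ω) hr r rfl rfl rfl

/-- Almost sure events contain paths which stay in a given state near a given time. -/
theorem exists_path {p : Ω → Prop} (hp : ∀ᵐ ω ∂P, p ω) {r : ℝ≥0} {i : Fin N}
    (hr : 0 < r ∨ i = C.x₀) : ∃ ω, p ω ∧ ∀ᶠ s in 𝓝 r, C.X s ω = i := by
  have h1 : ∃ᵐ ω ∂P, C.X r ω = i := by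
    rcases eq_zero_or_pos r with rfl | h
    · rcases hr with h | rfl
      · exact absurd h (lt_irrefl _)
      · exact C.initial.frequently
    · exact frequently_ae_iff.2 (C.charged r h i).ne'
  obtain ⟨ω, h2, h3, h4⟩ := (h1.and_eventually (hp.and (C.ae_notMem_jumps r))).exists
  refine ⟨ω, h3, ?_⟩
  filter_upwards [(C.isStepPath ω).eventually_eq_of_notMem_jumps h4] with s hs
  rw [hs, h2]

end MarkovChain

/-! ### Solutions read path by path. -/

theorem IsPrimitiveAt.congr {w h h' : ℝ≥0 → ℝ} {r : ℝ≥0} (H : IsPrimitiveAt w h r)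
    {V : Set ℝ≥0} (hV : V ∈ 𝓝 r) (hh : ∀ᵐ x ∂timeMeasure, x ∈ V → h x = h' x) :
    IsPrimitiveAt w h' r := by
  obtain ⟨U, hU, H⟩ := H
  obtain ⟨a, b, -, hn, hsub⟩ := exists_Icc_mem_subset_of_mem_nhds (inter_mem hU hV)
  refine ⟨Icc a b, hn, fun s hs t ht hst => ?_⟩
  have hae : h =ᵐ[timeMeasure.restrict (Ioc s t)] h' := by
    refine (ae_restrict_iff' measurableSet_Ioc).2 (hh.mono fun x hx hxI => hx ?_)
    exact (hsub ⟨hs.1.trans hxI.1.le, hxI.2.trans ht.2⟩).2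
  have := H s (hsub hs).1 t (hsub ht).1 hst
  exact ⟨this.1.congr hae, by rw [this.2, integral_congr_ae hae]⟩

theorem isPrimitiveAt_integral {h : ℝ≥0 → ℝ}
    (hh : ∀ t, IntegrableOn h (Ioc 0 t) timeMeasure) (r : ℝ≥0) :
    IsPrimitiveAt (fun t => ∫ u in Ioc 0 t, h u ∂timeMeasure) h r := by
  refine ⟨univ, univ_mem, fun s _ t _ hst => ?_⟩
  have h1 : IntegrableOn h (Ioc s t) timeMeasure :=
    (hh t).mono_set (Ioc_subset_Ioc_left zero_le)
  exact ⟨h1, (integral_Ioc_add zero_le hst (hh s) h1).2⟩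

/-- Continuity at `0` is not available: `u(0, e_i)` is arbitrary for `e_i ≠ X_0`. -/
theorem measurable_of_continuousAt_pos {w : ℝ≥0 → ℝ} (hw : ∀ r, 0 < r → ContinuousAt w r) :
    Measurable w := by
  refine measurable_of_measurable_on_compl_singleton 0 (Continuous.measurable ?_)
  refine continuousOn_iff_continuous_domRestrict.1 fun r hr => ?_
  exact (hw r (pos_iff_ne_zero.2 hr)).continuousWithinAt

/-- The left limits of `v(t, x_t)` for a function `v` which is continuous in time. -/
theorem IsStepPath.leftLim_comp {α : Type*} [TopologicalSpace α] [DiscreteTopology α]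
    {x : ℝ≥0 → α} (hx : IsStepPath x) {v : ℝ≥0 → α → ℝ} {t : ℝ≥0} (ht : 0 < t)
    (hv : ∀ i, ContinuousAt (fun t => v t i) t) {y : ℝ≥0 → ℝ} (hy : ∀ t, y t = v t (x t)) :
    Tendsto y (𝓝[<] t) (𝓝 (v t (Function.leftLim x t))) ∧
      Function.leftLim y t = v t (Function.leftLim x t) := by
  have : (𝓝[<] t).NeBot := nhdsLT_neBot_of_exists_lt ⟨0, ht⟩
  have h : Tendsto y (𝓝[<] t) (𝓝 (v t (Function.leftLim x t))) := by
    refine ((hv (Function.leftLim x t)).tendsto.mono_left nhdsWithin_le_nhds).congr' ?_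
    obtain ⟨U, hU, -, h1, -⟩ := hx.exists_nhds t
    filter_upwards [mem_nhdsWithin_of_mem_nhds hU, self_mem_nhdsWithin] with s hs hst
    rw [hy, h1 s hs hst]
  exact ⟨h, leftLim_eq_of_tendsto h⟩

namespace MarkovChain

variable {Ω : Type*} [m : MeasurableSpace Ω] {P : Measure Ω} {N : ℕ} (C : MarkovChain P N)

theorem dotProduct_jump_eq_zero {s : ℝ≥0} {ω : Ω} (hs : s ∉ jumps fun t => C.X t ω)
    (z : Fin N → ℝ) : z ⬝ᵥ (C.vec s ω - C.vecLeft s ω) = 0 := by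
  have : C.Xleft s ω = C.X s ω := by simpa [jumps, Xleft] using hs
  rw [dotProduct_jump, this, sub_self]

theorem finite_jump_support (Z : ℝ≥0 → Ω → Fin N → ℝ) (a b : ℝ≥0) (ω : Ω) :
    (Ioc a b ∩ Function.support fun s => Z s ω ⬝ᵥ (C.vec s ω - C.vecLeft s ω)).Finite := by
  refine ((C.isStepPath ω).finite_jumps a b).subset fun s hs => ⟨?_, hs.1⟩
  by_contra h
  exact hs.2 (C.dotProduct_jump_eq_zero h _)

theorem finsum_jumps_add (Z : ℝ≥0 → Ω → Fin N → ℝ) {a b c : ℝ≥0} (hab : a ≤ b) (hbc : b ≤ c)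
    (ω : Ω) : ∑ᶠ s ∈ Ioc a c, Z s ω ⬝ᵥ (C.vec s ω - C.vecLeft s ω) =
      (∑ᶠ s ∈ Ioc a b, Z s ω ⬝ᵥ (C.vec s ω - C.vecLeft s ω)) +
        ∑ᶠ s ∈ Ioc b c, Z s ω ⬝ᵥ (C.vec s ω - C.vecLeft s ω) := by
  rw [← Ioc_union_Ioc_eq_Ioc hab hbc]
  exact finsum_mem_union' (Ioc_disjoint_Ioc_of_le le_rfl) (C.finite_jump_support Z a b ω)
    (C.finite_jump_support Z b c ω)

theorem finsum_jumps_of_const (Z : ℝ≥0 → Ω → Fin N → ℝ) {a b : ℝ≥0} (hab : a < b) {ω : Ω}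
    (h : ∀ s ∈ Ico a b, C.X s ω = C.X a ω) :
    ∑ᶠ s ∈ Ioc a b, Z s ω ⬝ᵥ (C.vec s ω - C.vecLeft s ω) =
      Z b ω ⬝ᵥ (C.vec b ω - C.vecLeft b ω) := by
  rw [← finsum_mem_singleton (f := fun s => Z s ω ⬝ᵥ (C.vec s ω - C.vecLeft s ω)) (a := b)]
  refine finsum_mem_inter_support_eq' _ _ _ fun s hs => ⟨fun hI => ?_, fun hb => ?_⟩
  · by_contra hne
    exact hs (C.dotProduct_jump_eq_zero (IsStepPath.notMem_jumps_of_const h hI.1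
      (lt_of_le_of_ne hI.2 hne)) _)
  · obtain rfl : s = b := hb
    exact ⟨hab, le_rfl⟩

/-- The density of the absolutely continuous part of a solution. -/
noncomputable def drift (f : Ω → ℝ≥0 → ℝ → (Fin N → ℝ) → ℝ) (Y : ℝ≥0 → Ω → ℝ)
    (Z : ℝ≥0 → Ω → Fin N → ℝ) (ω : Ω) (u : ℝ≥0) : ℝ :=
  -f ω u (Function.leftLim (fun s => Y s ω) u) (Z u ω) - Z u ω ⬝ᵥ (C.A u *ᵥ C.vecLeft u ω)

variable {C}

theorem IsSolution.integrableOn_drift {f : Ω → ℝ≥0 → ℝ → (Fin N → ℝ) → ℝ} {Y : ℝ≥0 → Ω → ℝ}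
    {Z : ℝ≥0 → Ω → Fin N → ℝ} (h : C.IsSolution f Y Z) :
    ∀ᵐ ω ∂P, ∀ t, IntegrableOn (C.drift f Y Z ω) (Ioc 0 t) timeMeasure := by
  filter_upwards [h.integrable_driver, h.integrableM] with ω h1 h2 t
  exact (h1 t).neg.sub (h2 t)

theorem IsSolution.increment {f : Ω → ℝ≥0 → ℝ → (Fin N → ℝ) → ℝ} {Y : ℝ≥0 → Ω → ℝ}
    {Z : ℝ≥0 → Ω → Fin N → ℝ} (h : C.IsSolution f Y Z) :
    ∀ᵐ ω ∂P, ∀ s t, s ≤ t → Y t ω = Y s ω + ∫ u in Ioc s t, C.drift f Y Z ω u ∂timeMeasure +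
      ∑ᶠ r ∈ Ioc s t, Z r ω ⬝ᵥ (C.vec r ω - C.vecLeft r ω) := by
  filter_upwards [h.integrable_driver, h.integrableM, h.equation, h.integrableOn_drift] with
    ω h1 h2 h3 h4 s t hst
  have h5 : ∀ t, Y t ω = Y 0 ω + ∫ u in Ioc 0 t, C.drift f Y Z ω u ∂timeMeasure +
      ∑ᶠ s ∈ Ioc 0 t, Z s ω ⬝ᵥ (C.vec s ω - C.vecLeft s ω) := by
    intro t
    have : ∫ u in Ioc 0 t, C.drift f Y Z ω u ∂timeMeasure =
        -(∫ u in Ioc 0 t, f ω u (Function.leftLim (fun s => Y s ω) u) (Z u ω) ∂timeMeasure) -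
          ∫ u in Ioc 0 t, Z u ω ⬝ᵥ (C.A u *ᵥ C.vecLeft u ω) ∂timeMeasure := by
      rw [← integral_neg]
      exact integral_sub (h1 t).neg (h2 t)
    rw [h3 t, this, integralM]
    ring
  rw [h5 t, h5 s, C.finsum_jumps_add Z zero_le hst, (integral_Ioc_add zero_le hst (h4 s)
    ((h4 t).mono_set (Ioc_subset_Ioc_left zero_le))).2]
  ring

section FunctionOfChain

variable {f : Ω → ℝ≥0 → ℝ → (Fin N → ℝ) → ℝ} {Y : ℝ≥0 → Ω → ℝ} {Z : ℝ≥0 → Ω → Fin N → ℝ}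
  {u : ℝ≥0 → Fin N → ℝ}

/-- While the path rests in `i` there are no jump terms and `Y` is `u(·, e_i)`. One almost sure
event serves all `r` and `i`, so a single path of it suffices to learn about the deterministic `u`.
-/
theorem IsFunctionOfChain.ae_isPrimitiveAt (hu : C.IsFunctionOfChain Y u)
    (h : C.IsSolution f Y Z) : ∀ᵐ ω ∂P, ∀ r i, (∀ᶠ s in 𝓝 r, C.X s ω = i) →
      IsPrimitiveAt (fun t => u t i) (C.drift f Y Z ω) r := by
  filter_upwards [hu, h.integrableOn_drift, h.increment] with ω h1 h2 h3 r i hr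
  obtain ⟨a, b, -, hn, hsub⟩ := exists_Icc_mem_subset_of_mem_nhds hr
  refine ⟨Icc a b, hn, fun s hs t ht hst => ⟨(h2 t).mono_set (Ioc_subset_Ioc_left zero_le), ?_⟩⟩
  have h4 := h3 s t hst
  rw [h1 t, h1 s, hsub hs, hsub ht] at h4
  change u t i = u s i + _
  rw [h4]
  rcases hst.eq_or_lt with rfl | hlt
  · simp
  have hc : ∀ y ∈ Icc s t, C.X y ω = i := fun y hy => hsub ⟨hs.1.trans hy.1, hy.2.trans ht.2⟩
  rw [C.finsum_jumps_of_const Z hlt fun y hy => (hc y (Ico_subset_Icc_self hy)).trans (hsub hs).symm,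
    dotProduct_jump, hc t (right_mem_Icc.2 hst), show C.Xleft t ω = i from
      leftLim_eq_of_const hlt fun y hy => hc y (Ico_subset_Icc_self hy), sub_self, add_zero]

theorem measurable_of_continuousAt (hu : ∀ r, 0 < r → ∀ i, ContinuousAt (fun t => u t i) r) :
    Measurable u :=
  measurable_pi_iff.2 fun i => measurable_of_continuousAt_pos fun r hr => hu r hr i

theorem ae_leftLim_eq (hu : ∀ r, 0 < r → ∀ i, ContinuousAt (fun t => u t i) r) {y : ℝ≥0 → ℝ}
    {ω : Ω} (hy : ∀ t, y t = u t (C.X t ω)) :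
    ∀ᵐ t ∂timeMeasure, Function.leftLim y t = y t := by
  filter_upwards [(C.isStepPath ω).ae_leftLim_eq,
    compl_mem_ae_iff.2 (measure_singleton (μ := timeMeasure) 0)] with t h1 h2
  have ht : 0 < t := pos_iff_ne_zero.2 h2
  rw [((C.isStepPath ω).leftLim_comp ht (hu t ht) hy).2, h1, ← hy t]

variable [IsProbabilityMeasure P]

theorem IsFunctionOfChain.continuousAt (hu : C.IsFunctionOfChain Y u)
    (h : C.IsSolution f Y Z) {r : ℝ≥0} (hr : 0 < r) (i : Fin N) :
    ContinuousAt (fun t => u t i) r := by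
  obtain ⟨ω, h1, h2⟩ := C.exists_path (hu.ae_isPrimitiveAt h) (Or.inl hr : 0 < r ∨ i = C.x₀)
  exact (h1 r i h2).continuousAt

theorem IsFunctionOfChain.measurable (hu : C.IsFunctionOfChain Y u) (h : C.IsSolution f Y Z) :
    Measurable u :=
  measurable_of_continuousAt fun _ hr i => hu.continuousAt h hr i

/-- The jump of `Y` at `t` is computed twice: from the equation it is `Z_t^* ΔX_t`, from the
continuity of `u` in time it is `u(t, X_t) - u(t, X_{t-})`. -/
theorem IsFunctionOfChain.equivM (hu : C.IsFunctionOfChain Y u) (h : C.IsSolution f Y Z) :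
    C.EquivM Z (fun t _ => u t) := by
  rw [C.equivM_iff h.predictable (isStronglyPredictable_deterministic _ (hu.measurable h))]
  filter_upwards [hu, h.integrableOn_drift, h.increment] with ω h1 h2 h3 t
  rcases eq_zero_or_pos t with rfl | ht
  · rw [C.dotProduct_jump_eq_zero (zero_notMem_jumps _), C.dotProduct_jump_eq_zero
      (zero_notMem_jumps _)]
  have : (𝓝[<] t).NeBot := nhdsLT_neBot_of_exists_lt ⟨0, ht⟩
  have hX := C.isStepPath ω
  have h4 := (hX.leftLim_comp ht (hu.continuousAt h ht) h1).1
  have h5 := ((isPrimitiveAt_integral h2 t).continuousAt.tendsto.mono_left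
    (nhdsWithin_le_nhds (s := Iio t)))
  -- Just before `t` the path is constant, so `Y` without its continuous part is constant there and
  -- misses exactly the jump at `t`.
  have h6 : ∀ᶠ s in 𝓝[<] t, Y s ω - ∫ u in Ioc 0 s, C.drift f Y Z ω u ∂timeMeasure =
      Y t ω - ∫ u in Ioc 0 t, C.drift f Y Z ω u ∂timeMeasure -
        Z t ω ⬝ᵥ (C.vec t ω - C.vecLeft t ω) := by
    obtain ⟨U, hU, hUo, h7, -⟩ := hX.exists_nhds t
    filter_upwards [mem_nhdsWithin_of_mem_nhds hU, self_mem_nhdsWithin] with s hs hst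
    replace hst : s < t := hst
    rw [h3 s t hst.le, C.finsum_jumps_of_const Z hst fun y hy => ?_,
      (integral_Ioc_add zero_le hst.le (h2 s) ((h2 t).mono_set (Ioc_subset_Ioc_left zero_le))).2]
    · ring
    · rw [h7 s hs hst, h7 y (hUo.out hs (mem_of_mem_nhds hU) (Ico_subset_Icc_self hy)) hy.2]
  have h8 := tendsto_nhds_unique (h4.sub h5) (tendsto_const_nhds.congr' (h6.mono fun s hs => hs.symm))
  rw [C.dotProduct_jump (u t), ← h1 t, show u t (C.Xleft t ω) = _ from sub_eq_iff_eq_add.1 h8]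
  ring

end FunctionOfChain

section Drift

variable [IsProbabilityMeasure P]
variable {f : Ω → ℝ≥0 → ℝ → (Fin N → ℝ) → ℝ} {Y : ℝ≥0 → Ω → ℝ} {Z : ℝ≥0 → Ω → Fin N → ℝ}
  {u : ℝ≥0 → Fin N → ℝ}

/-- If `Z` is equivalent to the deterministic `u`, then along `u(t, X_t)` the drift is
that of the system for `u`. -/
theorem ae_drift_eq {F : Fin N → ℝ≥0 → ℝ → (Fin N → ℝ) → ℝ}
    (hF : C.InvariantDriver (C.chainDriver F)) (hZ : IsStronglyPredictable C.ℱ Z)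
    (hu : ∀ r, 0 < r → ∀ i, ContinuousAt (fun t => u t i) r)
    (hZu : C.EquivM Z (fun t _ => u t)) (hY : C.IsFunctionOfChain Y u) :
    ∀ᵐ ω ∂P, ∀ᵐ t ∂timeMeasure, C.drift (C.chainDriver F) Y Z ω t =
      -F (C.X t ω) t (u t (C.X t ω)) (u t) - u t ⬝ᵥ (C.A t *ᵥ e (C.X t ω)) := by
  have h1 := hF Z (fun t _ => u t) hZ
    (isStronglyPredictable_deterministic _ (measurable_of_continuousAt hu)) hZu
  have h2 := ae_ae_of_ae_prod_swap (p := fun t ω => ∀ y, C.chainDriver F ω t y (Z t ω) =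
    C.chainDriver F ω t y (u t)) h1
  filter_upwards [h2, hZu.ae_dotProduct_rate_eq, hY] with ω h3 h4 h5
  filter_upwards [h3, h4, (C.isStepPath ω).ae_leftLim_eq, ae_leftLim_eq hu h5] with
    t h6 h7 h8 h9
  have h10 : C.vecLeft t ω = e (C.X t ω) := congrArg e h8
  rw [drift, h6, h7, h9, h10, h5 t]
  rfl

end Drift

end MarkovChain

/-! ### The Markovian driver and the two implications. -/

theorem measurable_progressive_comp {Ω : Type*} [MeasurableSpace Ω] {N : ℕ}
    {x : ℝ≥0 → Ω → Fin N} {T : ℝ≥0} (hx : Measurable fun q : Iic T × Ω => x q.1 q.2)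
    {g : Fin N → ℝ≥0 → ℝ} (hg : ∀ i, Measurable (g i)) :
    Measurable fun q : (Iic T × Ω) × ℝ × (Fin N → ℝ) => g (x q.1.1 q.1.2) q.1.1 := by
  have h1 : Measurable fun p : Fin N × ℝ≥0 => g p.1 p.2 := measurable_from_prod_countable_right hg
  have h2 : Measurable fun q : Iic T × Ω => g (x q.1 q.2) q.1 :=
    h1.comp (hx.prodMk (measurable_subtype_coe.comp measurable_fst))
  exact h2.comp measurable_fst

namespace MarkovChain

variable {Ω : Type*} [m : MeasurableSpace Ω] {P : Measure Ω} {N : ℕ} {C : MarkovChain P N}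
variable {f : Ω → ℝ≥0 → ℝ → (Fin N → ℝ) → ℝ} {Y : ℝ≥0 → Ω → ℝ} {Z : ℝ≥0 → Ω → Fin N → ℝ}
  {u v : ℝ≥0 → Fin N → ℝ} {F : Fin N → ℝ≥0 → ℝ → (Fin N → ℝ) → ℝ}

theorem SquareIntegrableSup.congr {Y' : ℝ≥0 → Ω → ℝ} (hY : SquareIntegrableSup P Y)
    (h : ∀ᵐ ω ∂P, ∀ t, Y t ω = Y' t ω) : SquareIntegrableSup P Y' := by
  intro T
  refine lt_of_eq_of_lt (lintegral_congr_ae ?_) (hY T)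
  filter_upwards [h] with ω hω
  simp_rw [hω]

theorem ProgressiveDriver.measurable (hf : C.ProgressiveDriver f) :
    Measurable fun q : (ℝ≥0 × Ω) × ℝ × (Fin N → ℝ) => f q.1.2 q.1.1 q.2.1 q.2.2 := by
  refine measurable_of_tendsto_metrizable (f := fun (n : ℕ) (q : (ℝ≥0 × Ω) × ℝ × (Fin N → ℝ)) =>
    f q.1.2 (min q.1.1 n) q.2.1 q.2.2) (fun n => ?_) ?_
  · have h1 : Measurable fun q : (Iic (n : ℝ≥0) × Ω) × ℝ × (Fin N → ℝ) =>
        f q.1.2 q.1.1 q.2.1 q.2.2 := by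
      refine (hf n).mono (sup_le_sup_right (MeasurableSpace.comap_mono ?_) _) le_rfl
      exact sup_le_sup_left (MeasurableSpace.comap_mono (C.ℱ.le n)) _
    have h2 : Measurable fun q : (ℝ≥0 × Ω) × ℝ × (Fin N → ℝ) =>
        (((⟨min q.1.1 n, mem_Iic.2 (min_le_right q.1.1 n)⟩ : Iic (n : ℝ≥0)), q.1.2), q.2) :=
      ((((measurable_fst.comp measurable_fst).min measurable_const).subtype_mk).prodMk
        (measurable_snd.comp measurable_fst)).prodMk measurable_snd
    exact h1.comp h2
  · rw [tendsto_pi_nhds]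
    rintro ⟨⟨t, ω⟩, y, z⟩
    obtain ⟨n, hn⟩ := exists_nat_ge t
    refine tendsto_const_nhds.congr' ?_
    filter_upwards [eventually_ge_atTop n] with k hk
    rw [min_eq_left (hn.trans (by exact_mod_cast hk))]

theorem vec_dotProduct (v : ℝ≥0 → Fin N → ℝ) (t : ℝ≥0) (ω : Ω) :
    C.vec t ω ⬝ᵥ v t = v t (C.X t ω) := by
  rw [dotProduct_comm, vec, dotProduct_e]

theorem SolvesSystem.continuousAt (hv : C.SolvesSystem F v) {r : ℝ≥0} (hr : 0 < r) (i : Fin N) :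
    ContinuousAt (fun t => v t i) r := by
  refine IsPrimitiveAt.continuousAt (h := fun u => -F i u (v u i) (v u) - v u ⬝ᵥ (C.A u *ᵥ e i))
    ⟨Ioi 0, Ioi_mem_nhds hr, fun s hs t _ hst => hv i s t hst (Or.inl hs)⟩

theorem IsFunctionOfChain.eq (hu : C.IsFunctionOfChain Y u) (hv : C.IsFunctionOfChain Y v)
    {t : ℝ≥0} (ht : 0 < t) (i : Fin N) : v t i = u t i := by
  have h1 : ∃ᵐ ω ∂P, C.X t ω = i := frequently_ae_iff.2 (C.charged t ht i).ne'
  obtain ⟨ω, h2, h3, h4⟩ := (h1.and_eventually (hu.and hv)).exists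
  rw [← h2, ← h4 t, h3 t]

/-- The value of the driver along `Y_t = u(t, X_t)`, expressed through `u`. -/
noncomputable def driverOf (C : MarkovChain P N) (u : ℝ≥0 → Fin N → ℝ) (i : Fin N) (t : ℝ≥0) : ℝ :=
  -deriv (fun y : ℝ => u y.toNNReal i) t - u t ⬝ᵥ (C.A t *ᵥ e i)

/-- `deriv` is measurable for every function, with value `0` where no derivative exists, so no
exceptional set has to be removed. -/
theorem measurable_driverOf (hu : Measurable u) (i : Fin N) : Measurable (C.driverOf u i) := by
  have h1 : Measurable fun t : ℝ≥0 => deriv (fun y : ℝ => u y.toNNReal i) t :=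
    (measurable_deriv _).comp NNReal.continuous_coe.measurable
  have h2 : Measurable fun t => u t ⬝ᵥ (C.A t *ᵥ e i) := by
    simp only [dotProduct, mulVec_e]
    exact Finset.measurable_sum _ fun j _ =>
      ((measurable_pi_apply j).comp hu).mul (C.isRateMatrix.measurable j i)
  exact h1.neg.sub h2

variable [IsProbabilityMeasure P]

theorem ae_drift_eq_of_isMarkovianVersion (hF : C.IsMarkovianVersion f Y Z F)
    (hu : C.IsFunctionOfChain Y u) (h : C.IsSolution f Y Z) :
    ∀ᵐ ω ∂P, ∀ᵐ t ∂timeMeasure, C.drift f Y Z ω t =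
      -F (C.X t ω) t (u t (C.X t ω)) (u t) - u t ⬝ᵥ (C.A t *ᵥ e (C.X t ω)) := by
  have hc := fun r hr i => hu.continuousAt h (r := r) hr i
  have h1 := ae_ae_of_ae_prod_swap
    (p := fun t ω => f ω t (Y t ω) (Z t ω) = F (C.X t ω) t (Y t ω) (Z t ω)) hF.eq
  filter_upwards [h1, ae_drift_eq hF.invariant h.predictable hc (hu.equivM h) hu, hu] with
    ω h2 h3 h4
  filter_upwards [h2, h3, ae_leftLim_eq hc h4] with t h5 h6 h7
  rw [← h6, drift, drift, h7, h5]
  rfl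

/-- The function `u` with `Y_t = u(t, X_t)` solves the system of any Markovian version. -/
theorem IsFunctionOfChain.isDeterministicVersion (hu : C.IsFunctionOfChain Y u)
    (h : C.IsSolution f Y Z) (hF : C.IsMarkovianVersion f Y Z F) :
    C.IsDeterministicVersion F Y Z u where
  equiv := hu.equivM h
  initial := by
    filter_upwards [hu] with ω hω
    rw [vec_dotProduct, hω 0]
  squareIntegrable := SquareIntegrableSup.congr h.squareIntegrable <| by
    filter_upwards [hu] with ω hω t
    rw [vec_dotProduct, hω t]
  system := by
    intro i s t hst hs
    -- The system is local in time, so each `r` may use its own path resting in `i` near `r`.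
    refine eq_add_integral_of_isPrimitiveAt (w := fun t => u t i) hst fun r hsr _ => ?_
    have hr : 0 < r ∨ i = C.x₀ := hs.imp_left fun h => h.trans_le hsr
    obtain ⟨ω, ⟨h1, h2⟩, h3⟩ := C.exists_path
      ((hu.ae_isPrimitiveAt h).and (ae_drift_eq_of_isMarkovianVersion hF hu h)) hr
    refine (h1 r i h3).congr h3 (h2.mono fun x hx hxi => ?_)
    have hxi' : C.X x ω = i := hxi
    rw [hx, hxi']

/-- A deterministic version `v` of `Z` gives the solution `v(t, X_t)` of the equation. -/
theorem IsDeterministicVersion.isSolution (hv : C.IsDeterministicVersion F Y Z v)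
    (hF : C.InvariantDriver (C.chainDriver F)) (h : C.IsSolution f Y Z) :
    C.IsSolution (C.chainDriver F) (fun t ω => v t (C.X t ω)) Z := by
  have hc := fun r hr i => hv.system.continuousAt (r := r) hr i
  have hdrift := ae_drift_eq hF h.predictable hc hv.equiv
    (Y := fun t ω => v t (C.X t ω)) (ae_of_all _ fun ω t => rfl)
  have hjump := (C.equivM_iff h.predictable (isStronglyPredictable_deterministic _
    (measurable_of_continuousAt hc))).1 hv.equiv
  have key : ∀ᵐ ω ∂P, ∀ s t, s ≤ t →
      IntegrableOn (C.drift (C.chainDriver F) (fun t ω => v t (C.X t ω)) Z ω) (Ioc s t)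
        timeMeasure ∧
      v t (C.X t ω) = v s (C.X s ω) + ∫ r in Ioc s t,
        C.drift (C.chainDriver F) (fun t ω => v t (C.X t ω)) Z ω r ∂timeMeasure +
        ∑ᶠ r ∈ Ioc s t, Z r ω ⬝ᵥ (C.vec r ω - C.vecLeft r ω) := by
    filter_upwards [hdrift, hjump, C.initial] with ω h1 h2 h3 s t hst
    refine (C.isStepPath ω).rel_of_rel_of_const (R := fun s t =>
      IntegrableOn (C.drift (C.chainDriver F) (fun t ω => v t (C.X t ω)) Z ω) (Ioc s t)
        timeMeasure ∧
      v t (C.X t ω) = v s (C.X s ω) + ∫ r in Ioc s t,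
        C.drift (C.chainDriver F) (fun t ω => v t (C.X t ω)) Z ω r ∂timeMeasure +
        ∑ᶠ r ∈ Ioc s t, Z r ω ⬝ᵥ (C.vec r ω - C.vecLeft r ω)) (fun a => by simp) ?_ ?_ hst
    · intro a b c hab hbc h4 h5
      have h6 := integral_Ioc_add hab hbc h4.1 h5.1
      refine ⟨h6.1, ?_⟩
      rw [h5.2, h4.2, h6.2, C.finsum_jumps_add Z hab hbc]
      ring
    · intro a b hab hconst
      -- An interval starting at time `0` starts in `x₀`, the only state for which the system is
      -- given down to `0`.
      have ha : 0 < a ∨ C.X a ω = C.x₀ := by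
        rcases eq_zero_or_pos a with rfl | h
        · exact Or.inr h3
        · exact Or.inl h
      obtain ⟨h4, h5⟩ := hv.system (C.X a ω) a b hab.le ha
      have hae : (fun r => -F (C.X a ω) r (v r (C.X a ω)) (v r) -
          v r ⬝ᵥ (C.A r *ᵥ e (C.X a ω))) =ᵐ[timeMeasure.restrict (Ioc a b)]
          C.drift (C.chainDriver F) (fun t ω => v t (C.X t ω)) Z ω := by
        refine (ae_restrict_iff' measurableSet_Ioc).2 ?_
        filter_upwards [h1, compl_mem_ae_iff.2 (measure_singleton (μ := timeMeasure) b)] with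
          r h6 h7 h8
        rw [h6, hconst r ⟨h8.1.le, lt_of_le_of_ne h8.2 h7⟩]
      refine ⟨h4.congr hae, ?_⟩
      -- As `Z ∼_M v`, the jump term at `b` is `v_b(X_b) - v_b(X_a)`, just what the system for the
      -- state `X_a` leaves over.
      rw [C.finsum_jumps_of_const Z hab hconst, h2 b, dotProduct_jump,
        ← integral_congr_ae hae, show C.Xleft b ω = C.X a ω from leftLim_eq_of_const hab hconst,
        h5]
      ring
  have hint : ∀ᵐ ω ∂P, ∀ t : ℝ≥0, IntegrableOn (fun r => C.chainDriver F ω r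
      (Function.leftLim (fun s => v s (C.X s ω)) r) (Z r ω)) (Ioc 0 t) timeMeasure := by
    filter_upwards [key, h.integrableM] with ω h1 h2 t
    refine ((h1 0 t zero_le).1.neg.sub (h2 t)).congr (ae_of_all _ fun r => ?_)
    simp only [drift, Pi.sub_apply, Pi.neg_apply]
    ring
  refine ⟨fun t => ?_, ?_, h.predictable, hint, h.integrableM, ?_⟩
  · exact ((measurable_of_countable (v t)).comp (C.adapted_X t)).stronglyMeasurable
  · refine SquareIntegrableSup.congr hv.squareIntegrable (ae_of_all _ fun ω t => vec_dotProduct v t ω)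
  · filter_upwards [key, hint, h.integrableM] with ω h1 h2 h3 t
    have h4 : ∫ r in Ioc 0 t,
        C.drift (C.chainDriver F) (fun t ω => v t (C.X t ω)) Z ω r ∂timeMeasure =
        -(∫ r in Ioc 0 t, C.chainDriver F ω r (Function.leftLim (fun s => v s (C.X s ω)) r)
          (Z r ω) ∂timeMeasure) -
          ∫ r in Ioc 0 t, Z r ω ⬝ᵥ (C.A r *ᵥ C.vecLeft r ω) ∂timeMeasure := by
      rw [← integral_neg]
      exact integral_sub (h2 t).neg (h3 t)
    rw [(h1 0 t zero_le).2, h4, integralM]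
    ring

theorem IsDeterministicVersion.isFunctionOfChain (hv : C.IsDeterministicVersion F Y Z v)
    (hF : C.InvariantDriver (C.chainDriver F)) (h : C.IsSolution f Y Z)
    (honly : C.IsOnlySolution (C.chainDriver F) Y Z) : C.IsFunctionOfChain Y v := by
  have h0 : (fun ω => v 0 (C.X 0 ω)) =ᵐ[P] Y 0 := by
    filter_upwards [hv.initial] with ω hω
    rw [← hω, vec_dotProduct]
  filter_upwards [honly _ (hv.isSolution hF h) h0] with ω hω t using (hω t).symm

theorem IsFunctionOfChain.ae_driver_eq (hu : C.IsFunctionOfChain Y u) (h : C.IsSolution f Y Z) :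
    ∀ᵐ ω ∂P, ∀ᵐ t ∂timeMeasure,
      f ω t (Function.leftLim (fun s => Y s ω) t) (Z t ω) = C.driverOf u (C.X t ω) t := by
  filter_upwards [hu.ae_isPrimitiveAt h, (hu.equivM h).ae_dotProduct_rate_eq] with ω h1 h2
  have h3 : ∀ᵐ t ∂timeMeasure,
      deriv (fun y : ℝ => u y.toNNReal (C.X t ω)) t = C.drift f Y Z ω t := by
    -- Away from the jump times the state is locally constant, so the exceptional set is locally
    -- null there and hence null; the jump times themselves are null.
    have h4 : timeMeasure ({t | ¬ deriv (fun y : ℝ => u y.toNNReal (C.X t ω)) t =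
        C.drift f Y Z ω t} \ jumps fun s => C.X s ω) = 0 := by
      refine measure_null_of_locally_null _ fun r hr => ?_
      have h5 := (C.isStepPath ω).eventually_eq_of_notMem_jumps hr.2
      obtain ⟨V, hV, h6⟩ := (h1 r _ h5).ae_deriv_eq
      refine ⟨_, inter_mem_nhdsWithin _ (inter_mem hV h5),
        measure_mono_null (fun t ht => ?_) (ae_iff.1 h6)⟩
      obtain ⟨⟨h7, -⟩, h8, h9⟩ := ht
      have h9' : C.X t ω = C.X r ω := h9
      rw [← h9']
      exact fun h => h7 (h h8)
    refine ae_iff.2 (measure_mono_null (fun t ht => ?_)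
      (measure_union_null h4 (C.isStepPath ω).timeMeasure_jumps))
    by_cases h : t ∈ jumps fun s => C.X s ω
    · exact Or.inr h
    · exact Or.inl ⟨ht, h⟩
  filter_upwards [h2, h3, (C.isStepPath ω).ae_leftLim_eq] with t h4 h5 h6
  have h7 : C.vecLeft t ω = e (C.X t ω) := congrArg e h6
  rw [driverOf, h5, drift, h4, h7]
  ring

/-- The witness ignores `y` and `z`: invariance is trivial, and the right-hand side of the equation
does not involve the solution, so `Z` and the initial value determine it. -/
theorem IsFunctionOfChain.exists_isMarkovianVersion (hu : C.IsFunctionOfChain Y u)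
    (h : C.IsSolution f Y Z) (hf : C.ProgressiveDriver f) :
    ∃ F, C.IsMarkovianVersion f Y Z F ∧ C.IsOnlySolution (C.chainDriver F) Y Z := by
  have hum := hu.measurable h
  have hae := hu.ae_driver_eq h
  have hc := fun r hr i => hu.continuousAt h (r := r) hr i
  refine ⟨fun i t _ _ => C.driverOf u i t, ⟨fun T => ?_, fun Z Z' _ _ _ => ae_of_all _ fun q y => rfl,
    ?_⟩, fun Y' hY' h0 => ?_⟩
  · exact @measurable_progressive_comp Ω (C.ℱ T) N C.X T (C.progressive_X T) (C.driverOf u)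
      (measurable_driverOf hum)
  · have hZ : Measurable fun q : ℝ≥0 × Ω => Z q.1 q.2 :=
      h.predictable.measurable.mono (predictable_le _) le_rfl
    have huX : Measurable fun q : ℝ≥0 × Ω => u q.1 (C.X q.1 q.2) :=
      (measurable_from_prod_countable_right (f := fun p : Fin N × ℝ≥0 => u p.2 p.1)
        fun i => (measurable_pi_apply i).comp hum).comp
        (C.measurable_uncurry_X.prodMk measurable_fst)
    -- Passing from pathwise null sets to `dt × dP`-null sets requires joint measurability, which
    -- holds for `u(t, X_t)`; `Y` is only known to be adapted.
    have h1 : Measurable fun q : ℝ≥0 × Ω => f q.2 q.1 (u q.1 (C.X q.1 q.2)) (Z q.1 q.2) :=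
      hf.measurable.comp (measurable_id.prodMk (huX.prodMk hZ))
    have h2 : Measurable fun q : ℝ≥0 × Ω => C.driverOf u (C.X q.1 q.2) q.1 :=
      (measurable_from_prod_countable_right (f := fun p : Fin N × ℝ≥0 => C.driverOf u p.1 p.2)
        fun i => measurable_driverOf hum i).comp (C.measurable_uncurry_X.prodMk measurable_fst)
    have h3 : ∀ᵐ q ∂timeMeasure.prod P, f q.2 q.1 (u q.1 (C.X q.1 q.2)) (Z q.1 q.2) =
        C.driverOf u (C.X q.1 q.2) q.1 := by
      refine ae_prod_of_ae_ae_swap (p := fun t ω => f ω t (u t (C.X t ω)) (Z t ω) =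
        C.driverOf u (C.X t ω) t) (measurableSet_eq_fun h1 h2) ?_
      filter_upwards [hae, hu] with ω h4 h5
      filter_upwards [h4, ae_leftLim_eq hc h5] with t h6 h7
      rw [← h5 t, ← h7, h6]
    have h4 : ∀ᵐ q ∂timeMeasure.prod P, ∀ t, Y t q.2 = u t (C.X t q.2) :=
      Measure.quasiMeasurePreserving_snd.ae (p := fun ω => ∀ t, Y t ω = u t (C.X t ω)) hu
    filter_upwards [h3, h4] with q h5 h6
    rw [h6 q.1, h5]
  · filter_upwards [hY'.equation, h.equation, hae, h0] with ω h1 h2 h3 h4 t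
    rw [h1 t, h2 t, h4, setIntegral_congr_ae measurableSet_Ioc (h3.mono fun t ht _ => ht)]
    rfl

end MarkovChain

end MarkovBSDE

theorem theorem3p2 {Ω : Type*} [MeasurableSpace Ω] (P : Measure Ω) [IsProbabilityMeasure P]
    {N : ℕ} (C : MarkovBSDE.MarkovChain P N)
    (f : Ω → ℝ≥0 → ℝ → (Fin N → ℝ) → ℝ) (hf : C.ProgressiveDriver f)
    (Y : ℝ≥0 → Ω → ℝ) (Z : ℝ≥0 → Ω → Fin N → ℝ) (hYZ : C.IsSolution f Y Z) :
    ((∃ u : ℝ≥0 → Fin N → ℝ, C.IsFunctionOfChain Y u) ↔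
      ∃ F : Fin N → ℝ≥0 → ℝ → (Fin N → ℝ) → ℝ,
        C.IsMarkovianVersion f Y Z F ∧ C.IsOnlySolution (C.chainDriver F) Y Z ∧
        ∃ v : ℝ≥0 → Fin N → ℝ, C.IsDeterministicVersion F Y Z v) ∧
    (∀ u : ℝ≥0 → Fin N → ℝ, C.IsFunctionOfChain Y u →
      C.EquivM Z (fun t _ => u t) ∧
      (∀ F : Fin N → ℝ≥0 → ℝ → (Fin N → ℝ) → ℝ,
        C.IsMarkovianVersion f Y Z F → C.IsDeterministicVersion F Y Z u) ∧
      (∀ (F : Fin N → ℝ≥0 → ℝ → (Fin N → ℝ) → ℝ) (v : ℝ≥0 → Fin N → ℝ),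
        C.IsMarkovianVersion f Y Z F → C.IsOnlySolution (C.chainDriver F) Y Z →
        C.IsDeterministicVersion F Y Z v → ∀ t : ℝ≥0, 0 < t → ∀ i, v t i = u t i)) := by
  refine ⟨⟨?_, ?_⟩, fun u hu => ⟨hu.equivM hYZ, fun F hF => hu.isDeterministicVersion hYZ hF,
    fun F v hF honly hv t ht i =>
      hu.eq (hv.isFunctionOfChain hF.invariant hYZ honly) ht i⟩⟩
  · rintro ⟨u, hu⟩
    obtain ⟨F, hF, honly⟩ := hu.exists_isMarkovianVersion hYZ hf
    exact ⟨F, hF, honly, u, hu.isDeterministicVersion hYZ hF⟩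
  · rintro ⟨F, hF, honly, v, hv⟩
    exact ⟨v, hv.isFunctionOfChain hF.invariant hYZ honly⟩
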